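/- Let $\mathbb D=\{\zeta\in\mathbb C:|\zeta|<1\}$, $\mathbb T=\{t\in\mathbb C:|t|=1\}$, let $\mathbb E=(\mathbb C\cup\{\infty\})\setminus(\mathbb D\cup\mathbb T)$, and let $m$ be the normalized Lebesgue measure on $\mathbb T$. For $G\in\{\mathbb D,\mathbb E\}$ let $\mathcal{NM}(G)$ be the set of all meromorphic functions in $G$ which can be represented as a quotient of two bounded holomorphic functions in $G$ (with denominator not identically zero). Each $h\in\mathcal{NM}(G)$ has a Borel measurable boundary function $\underline h:\mathbb T\to\mathbb C$, determined $m$-a.e. by $\underline h(t)=\lim_{r\to1-0}h(rt)$ if $G=\mathbb D$, and by $\underline h(t)=\lim_{r\to1+0}h(rt)$ if $G=\mathbb E$. An *outer function* in $\mathcal N(\mathbb D)$ (the class of functions in $\mathcal{NM}(\mathbb D)$ that are holomorphic in $\mathbb D$) is a function $D:\mathbb D\to\mathbb C$ of the form $$D(\zeta)=\alpha\exp\Big\{\int_{\mathbb T}\frac{t+\zeta}{t-\zeta}\,\ln[k(t)]\,m(dt)\Big\},\qquad \zeta\in\mathbb D,$$ with some $\alpha\in\mathbb T$ and some Borel measurable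 $k:\mathbb T\to[0,+\infty)$ satisfying $\int_{\mathbb T}|\ln[k(t)]|\,m(dt)<+\infty$ (where $\ln 0=-\infty$). An *inner function* is a holomorphic function $I:\mathbb D\to\mathbb C$ with $|I|\le 1$ in $\mathbb D$ and $|\underline I|=1$ $m$-a.e. on $\mathbb T$. A function $h\in\mathcal{NM}(\mathbb D)$ is called *pseudocontinuable* if there is $h^{\#}\in\mathcal{NM}(\mathbb E)$ such that $\underline h=\underline{h^{\#}}$ $m$-a.e. on $\mathbb T$. **Proposition.** Let $D$ be an outer function in $\mathcal N(\mathbb D)$. Then $D$ is pseudocontinuable if and only if there exist inner functions $I_1,I_2$ such that $$\underline D\cdot(\underline D^{\,*})^{-1}=\underline{I_2}\cdot\underline{I_1}^{\,-1}$$ holds $m$-a.e. on $\mathbb T$, where ${}^*$ denotes complex conjugation. -/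

import Mathlib

open MeasureTheory Filter Topology

noncomputable section

namespace Pseudocont

/-- The open unit disk `{ζ ∈ ℂ : |ζ| < 1}`. -/
def disk : Set ℂ := Metric.ball 0 1

/-- The exterior of the closed unit disk in the extended complex plane `ℂ ∪ {∞}`
(it contains the point `∞`). -/
def exterior : Set (OnePoint ℂ) := ((fun z : ℂ => (z : OnePoint ℂ)) '' Metric.closedBall 0 1)ᶜ

/-- The Borel sigma-algebra of the unit circle. -/
instance instMeasurableSpaceCircle : MeasurableSpace Circle := borel Circle

instance instBorelSpaceCircle : BorelSpace Circle := ⟨rfl⟩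

/-- The normalized linear Lebesgue-Borel measure on the unit circle: the image of the
normalized Lebesgue measure on `(0, 2π]` under `θ ↦ exp (iθ)`. -/
def m : Measure Circle :=
  (ENNReal.ofReal (2 * Real.pi))⁻¹ •
    (volume.restrict (Set.Ioc (0 : ℝ) (2 * Real.pi))).map Circle.exp

/-! ### Holomorphic and meromorphic functions on the exterior domain -/

/-- The inverse of the chart `z ↦ 1 / z` of the extended complex plane at `∞`. -/
def chartInfty (w : ℂ) : OnePoint ℂ :=
  open Classical in if w = 0 then OnePoint.infty else ((w⁻¹ : ℂ) : OnePoint ℂ)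

/-- `f` is holomorphic at every point of the set `G` in the extended complex plane; at `∞`
holomorphy is tested in the chart `z ↦ 1 / z`. -/
def HolomorphicOnSphere (f : OnePoint ℂ → ℂ) (G : Set (OnePoint ℂ)) : Prop :=
  (∀ z : ℂ, (z : OnePoint ℂ) ∈ G → AnalyticAt ℂ (fun w : ℂ => f (w : OnePoint ℂ)) z) ∧
    (OnePoint.infty ∈ G → AnalyticAt ℂ (fun w : ℂ => f (chartInfty w)) 0)

/-- `f` is meromorphic at every point of the set `G` in the extended complex plane; at `∞`
meromorphy is tested in the chart `z ↦ 1 / z`. As in `MeromorphicOn`, values at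
isolated points are immaterial. -/
def MeromorphicOnSphere (f : OnePoint ℂ → ℂ) (G : Set (OnePoint ℂ)) : Prop :=
  (∀ z : ℂ, (z : OnePoint ℂ) ∈ G → MeromorphicAt (fun w : ℂ => f (w : OnePoint ℂ)) z) ∧
    (OnePoint.infty ∈ G → MeromorphicAt (fun w : ℂ => f (chartInfty w)) 0)

/-! ### The meromorphic Nevanlinna classes

A meromorphic function is represented by a complex-valued function whose values at the zeros of
the denominator (in particular at poles) are immaterial. -/

/-- The Nevanlinna class of the unit disk: meromorphic functions which are quotients of two bounded
holomorphic functions, the denominator not vanishing identically. -/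
def NevanlinnaDisk (h : ℂ → ℂ) : Prop :=
  MeromorphicOn h disk ∧
    ∃ f g : ℂ → ℂ,
      DifferentiableOn ℂ f disk ∧ (∃ C : ℝ, ∀ z ∈ disk, ‖f z‖ ≤ C) ∧
      DifferentiableOn ℂ g disk ∧ (∃ C : ℝ, ∀ z ∈ disk, ‖g z‖ ≤ C) ∧
      (∃ z ∈ disk, g z ≠ 0) ∧
      ∀ z ∈ disk, g z ≠ 0 → h z = f z / g z

/-- The Nevanlinna class of the exterior domain: meromorphic functions which are quotients of two
bounded holomorphic functions, the denominator not vanishing identically. -/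
def NevanlinnaExterior (h : OnePoint ℂ → ℂ) : Prop :=
  MeromorphicOnSphere h exterior ∧
    ∃ f g : OnePoint ℂ → ℂ,
      HolomorphicOnSphere f exterior ∧ (∃ C : ℝ, ∀ z ∈ exterior, ‖f z‖ ≤ C) ∧
      HolomorphicOnSphere g exterior ∧ (∃ C : ℝ, ∀ z ∈ exterior, ‖g z‖ ≤ C) ∧
      (∃ z ∈ exterior, g z ≠ 0) ∧
      ∀ z ∈ exterior, g z ≠ 0 → h z = f z / g z

/-! ### Boundary functions -/

/-- `u` is a boundary function of `h`, a function on the unit disk: `u` is Borel measurable and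
`h (r t) → u t` as `r → 1 - 0`, for almost every `t` on the unit circle. -/
def IsBoundaryDisk (h : ℂ → ℂ) (u : Circle → ℂ) : Prop :=
  Measurable u ∧
    ∀ᵐ t : Circle ∂m, Tendsto (fun r : ℝ => h ((r : ℂ) * (t : ℂ))) (𝓝[<] 1) (𝓝 (u t))

/-- `u` is a boundary function of `h`, a function on the exterior domain: `u` is Borel measurable
and `h (r t) → u t` as `r → 1 + 0`, for almost every `t` on the unit circle. -/
def IsBoundaryExterior (h : OnePoint ℂ → ℂ) (u : Circle → ℂ) : Prop :=
  Measurable u ∧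
    ∀ᵐ t : Circle ∂m, Tendsto (fun r : ℝ => h (((r : ℂ) * (t : ℂ) : ℂ) : OnePoint ℂ)) (𝓝[>] 1) (𝓝 (u t))

/-! ### Outer, inner and pseudocontinuable functions -/

/-- Outer functions in the Nevanlinna class of the unit disk. (The integrability of `ln k`, where
`ln 0 = -∞`, includes that `k > 0` almost everywhere.) -/
def IsOuter (D : ℂ → ℂ) : Prop :=
  ∃ (α : Circle) (k : Circle → ℝ), Measurable k ∧ (∀ t, 0 ≤ k t) ∧ (∀ᵐ t : Circle ∂m, 0 < k t) ∧
    Integrable (fun t => Real.log (k t)) m ∧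
    ∀ ζ ∈ disk, D ζ =
      (α : ℂ) * Complex.exp (∫ t : Circle, ((t : ℂ) + ζ) / ((t : ℂ) - ζ) * (Real.log (k t) : ℂ) ∂m)

/-- The Schur class: holomorphic functions mapping the unit disk to the closed unit disk. -/
def IsSchur (Θ : ℂ → ℂ) : Prop :=
  DifferentiableOn ℂ Θ disk ∧ ∀ ζ ∈ disk, ‖Θ ζ‖ ≤ 1

/-- Inner functions: Schur functions with boundary function unimodular almost everywhere. -/
def IsInner (I : ℂ → ℂ) : Prop :=
  IsSchur I ∧ ∃ u : Circle → ℂ, IsBoundaryDisk I u ∧ ∀ᵐ t : Circle ∂m, ‖u t‖ = 1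

/-- `h` belongs to the Nevanlinna class of the unit disk and admits a pseudocontinuation into the
exterior domain, i.e. there is `hs` in the Nevanlinna class of the exterior domain such that
the boundary functions of `h` and `hs` coincide almost everywhere. -/
def Pseudocontinuable (h : ℂ → ℂ) : Prop :=
  NevanlinnaDisk h ∧ ∃ hs : OnePoint ℂ → ℂ, NevanlinnaExterior hs ∧
    ∃ u v : Circle → ℂ, IsBoundaryDisk h u ∧ IsBoundaryExterior hs v ∧ u =ᵐ[m] v

end Pseudocont

end

namespace Pseudocont

open ComplexConjugate

/-! Reflection in the circle, `h ↦ conj (h (1 / conj z))`, exchanges bounded holomorphic functions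
on the disk and on the exterior and conjugates boundary values. If `D = f / g` has a
pseudocontinuation `fs / gs`, let `F`, `G` be the reflections of `fs`, `gs`. On the circle `conj D =
F / G`, hence `D / conj D = (f G) / (g F)`, a unimodular quotient of boundary values of bounded
functions. Numerator and denominator have the same boundary modulus, hence the same outer factor;
dividing it out leaves a quotient of inner functions (`exists_isInner_of_norm_boundary_eq`).
Conversely, if `D / conj D = I₂ / I₁` on the circle, then `D = conj (D I₁ / I₂)` there, and the
reflection of `D I₁ / I₂` is the pseudocontinuation (`IsOuter.pseudocontinuable`).

The analytic input is the boundary theory of a bounded holomorphic `f`. Radial limits exist a.e.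
(`ae_exists_tendsto_radial`): a primitive of `f` is Lipschitz, hence differentiable a.e. along the
circle, and a kernel estimate turns its derivative into the radial limit of `f`. The logarithm of
the boundary modulus is integrable unless `f` vanishes identically
(`boundary_ne_zero_and_integrable_log`), and its Poisson integral dominates `log |f|`
(`norm_le_exp_integral_log`). So `f` divided by the outer function of its boundary modulus is Schur,
and it is inner because Poisson integrals converge in `L¹` to their boundary data
(`isInner_div_outer`). -/

/-! ### The normalized measure on the circle -/

theorem circleMap_zero_one (θ : ℝ) : circleMap 0 1 θ = (Circle.exp θ : ℂ) := by
  simp [circleMap]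

theorem two_pi_ennreal_ne_zero : ENNReal.ofReal (2 * Real.pi) ≠ 0 := by
  simpa using Real.pi_pos

instance instIsProbabilityMeasure_m : IsProbabilityMeasure m := by
  constructor
  rw [m, Measure.smul_apply, Measure.map_apply Circle.exp.continuous.measurable MeasurableSet.univ]
  simp only [Set.preimage_univ, Measure.restrict_apply_univ, Real.volume_Ioc, sub_zero, smul_eq_mul]
  exact ENNReal.inv_mul_cancel two_pi_ennreal_ne_zero ENNReal.ofReal_ne_top

@[fun_prop]
theorem continuous_coe : Continuous fun t : Circle => (t : ℂ) := continuous_subtype_val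

variable {E : Type*} [NormedAddCommGroup E]

theorem aestronglyMeasurable_m_iff {g : Circle → E} :
    AEStronglyMeasurable g m ↔ AEStronglyMeasurable g
      ((volume.restrict (Set.Ioc (0 : ℝ) (2 * Real.pi))).map Circle.exp) := by
  rw [m]
  refine ⟨fun h => h.mono_ac ?_, fun h => h.mono_ac Measure.smul_absolutelyContinuous⟩
  refine Measure.AbsolutelyContinuous.mk fun s _ hs => ?_
  rw [Measure.smul_apply, smul_eq_mul, mul_eq_zero] at hs
  exact hs.resolve_left (ENNReal.inv_ne_zero.2 ENNReal.ofReal_ne_top)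

theorem integral_m [NormedSpace ℝ E] {g : Circle → E} (hg : AEStronglyMeasurable g m) :
    ∫ t, g t ∂m = (2 * Real.pi)⁻¹ • ∫ θ in (0 : ℝ)..2 * Real.pi, g (Circle.exp θ) := by
  rw [intervalIntegral.integral_of_le Real.two_pi_pos.le,
    ← integral_map Circle.exp.continuous.aemeasurable (aestronglyMeasurable_m_iff.1 hg), m,
    integral_smul_measure, ENNReal.toReal_inv, ENNReal.toReal_ofReal Real.two_pi_pos.le]

theorem intervalIntegrable_comp_exp {g : Circle → E} (hg : Integrable g m) :
    IntervalIntegrable (fun θ => g (Circle.exp θ)) volume 0 (2 * Real.pi) := by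
  rw [intervalIntegrable_iff_integrableOn_Ioc_of_le Real.two_pi_pos.le, IntegrableOn]
  refine (integrable_map_measure (aestronglyMeasurable_m_iff.1 hg.1)
    Circle.exp.continuous.aemeasurable).1 ?_
  rw [m] at hg
  exact (integrable_smul_measure (ENNReal.inv_ne_zero.2 ENNReal.ofReal_ne_top)
    (by simpa using Real.pi_pos)).1 hg

theorem integral_m_eq_circleAverage [NormedSpace ℝ E] {g : ℂ → E}
    (hg : AEStronglyMeasurable (fun t : Circle => g t) m) :
    ∫ t : Circle, g t ∂m = Real.circleAverage g 0 1 := by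
  rw [integral_m hg, Real.circleAverage_def]
  simp_rw [circleMap_zero_one]

/-- The angle of a point of the circle, normalized to lie in `(0, 2π]`. -/
noncomputable def angle (t : Circle) : ℝ :=
  if (t : ℂ).arg ≤ 0 then (t : ℂ).arg + 2 * Real.pi else (t : ℂ).arg

theorem measurable_angle : Measurable angle := by
  have h : Measurable fun t : Circle => (t : ℂ).arg :=
    Complex.measurable_arg.comp continuous_coe.measurable
  exact Measurable.ite (measurableSet_le h measurable_const) (h.add_const _) h

theorem angle_exp {θ : ℝ} (h : θ ∈ Set.Ioc 0 (2 * Real.pi)) : angle (Circle.exp θ) = θ := by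
  obtain ⟨h0, h1⟩ := h
  have hpi := Real.pi_pos
  rcases le_or_gt θ Real.pi with h2 | h2
  · rw [angle, Circle.arg_exp (by linarith) h2, if_neg (by linarith)]
  · have : Circle.exp θ = Circle.exp (θ - 2 * Real.pi) := by simp
    rw [angle, this, Circle.arg_exp (by linarith) (by linarith), if_pos (by linarith)]
    ring

/-- No measurability of `p` is available, so a measurable null superset is taken on the line and
carried to the circle as a preimage under `angle`, a measurable section of `Circle.exp`. -/
theorem ae_m_of_ae_exp {p : Circle → Prop} (h : ∀ᵐ θ : ℝ, p (Circle.exp θ)) :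
    ∀ᵐ t ∂m, p t := by
  obtain ⟨N, hN, hNm, hN0⟩ := exists_measurable_superset_of_null (show volume _ = 0 from h)
  have hz : m (angle ⁻¹' N) = 0 := by
    rw [m, Measure.smul_apply, Measure.map_apply Circle.exp.continuous.measurable
      (measurable_angle hNm), Measure.restrict_apply
      (Circle.exp.continuous.measurable (measurable_angle hNm))]
    have : Circle.exp ⁻¹' (angle ⁻¹' N) ∩ Set.Ioc 0 (2 * Real.pi) ⊆ N := by
      rintro θ ⟨h1, h2⟩
      simpa [angle_exp h2] using h1
    rw [measure_mono_null this hN0, smul_zero]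
  refine measure_mono_null (fun t ht => ?_) hz
  refine hN ?_
  have : Circle.exp (angle t) = t := by
    rw [angle]
    split_ifs <;> simp [Circle.exp_arg]
  simpa [this] using ht

/-! ### Kernels -/

theorem mem_disk {z : ℂ} : z ∈ disk ↔ ‖z‖ < 1 := by simp [disk]

theorem isOpen_disk : IsOpen disk := Metric.isOpen_ball

theorem norm_sub_pos {z : ℂ} (hz : z ∈ disk) (t : Circle) : 0 < ‖(t : ℂ) - z‖ := by
  rw [norm_pos_iff, sub_ne_zero]
  rintro rfl
  simp [mem_disk, Circle.norm_coe] at hz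

theorem sub_ne_zero_of_mem_disk {z : ℂ} (hz : z ∈ disk) (t : Circle) : (t : ℂ) - z ≠ 0 :=
  norm_pos_iff.1 (norm_sub_pos hz t)

/-- The Poisson kernel of the unit disk. -/
noncomputable def poisson (z : ℂ) (t : Circle) : ℝ := (1 - ‖z‖ ^ 2) / ‖(t : ℂ) - z‖ ^ 2

theorem poisson_eq (z : ℂ) (t : Circle) : poisson z t = poissonKernel 0 z t := by
  simp [poisson, poissonKernel_def, Circle.norm_coe]

theorem re_herglotz (z : ℂ) (t : Circle) : (((t : ℂ) + z) / (t - z)).re = poisson z t := by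
  rw [poisson_eq, poissonKernel_eq_re_herglotzRieszKernel]
  simp [herglotzRieszKernel_def]

theorem one_sub_norm_sq_pos {z : ℂ} (hz : z ∈ disk) : 0 < 1 - ‖z‖ ^ 2 := by
  have := mem_disk.1 hz
  nlinarith [norm_nonneg z]

theorem poisson_pos {z : ℂ} (hz : z ∈ disk) (t : Circle) : 0 < poisson z t :=
  div_pos (one_sub_norm_sq_pos hz) (pow_pos (norm_sub_pos hz t) 2)

theorem continuous_poisson {z : ℂ} (hz : z ∈ disk) : Continuous (poisson z) := by
  refine Continuous.div (by fun_prop) (by fun_prop) fun t => ?_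
  exact (pow_pos (norm_sub_pos hz t) 2).ne'

theorem continuous_herglotz {z : ℂ} (hz : z ∈ disk) :
    Continuous fun t : Circle => ((t : ℂ) + z) / (t - z) :=
  Continuous.div (by fun_prop) (by fun_prop) (sub_ne_zero_of_mem_disk hz)

theorem exists_bound_of_continuous {f : Circle → E} (hf : Continuous f) :
    ∃ C, ∀ t, ‖f t‖ ≤ C := by
  obtain ⟨C, hC⟩ := isCompact_univ.exists_bound_of_continuousOn hf.continuousOn
  exact ⟨C, fun t => hC t trivial⟩

theorem integrable_of_continuous {f : Circle → E} (hf : Continuous f) : Integrable f m := by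
  obtain ⟨C, hC⟩ := exists_bound_of_continuous hf
  exact Integrable.of_bound hf.aestronglyMeasurable C (ae_of_all _ hC)

theorem integrable_continuous_mul {𝕜 : Type*} [RCLike 𝕜] {f g : Circle → 𝕜} (hf : Continuous f)
    (hg : Integrable g m) : Integrable (fun t => f t * g t) m := by
  obtain ⟨C, hC⟩ := exists_bound_of_continuous hf
  exact hg.bdd_mul hf.aestronglyMeasurable (ae_of_all _ hC)

theorem continuous_restrict_circle {f : ℂ → ℂ} (hf : DiffContOnCl ℂ f disk) :
    Continuous fun t : Circle => f t := by
  have h := hf.continuousOn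
  rw [disk, closure_ball _ one_ne_zero] at h
  exact h.comp_continuous continuous_coe (by simp [Circle.norm_coe])

theorem integral_poisson_mul {f : ℂ → ℂ} (hf : DiffContOnCl ℂ f disk) {z : ℂ} (hz : z ∈ disk) :
    ∫ t : Circle, (poisson z t : ℂ) * f t ∂m = f z := by
  rw [← hf.circleAverage_poissonKernel_smul hz, ← integral_m_eq_circleAverage]
  · simp [poisson_eq]
  · have : Continuous fun t : Circle => (poisson z t : ℂ) * f t :=
      (Complex.continuous_ofReal.comp (continuous_poisson hz)).mul (continuous_restrict_circle hf)
    simpa [poisson_eq] using this.aestronglyMeasurable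

theorem integral_poisson {z : ℂ} (hz : z ∈ disk) : ∫ t : Circle, poisson z t ∂m = 1 := by
  have := integral_poisson_mul (f := fun _ => 1) diffContOnCl_const hz
  simp only [mul_one] at this
  rw [integral_complex_ofReal] at this
  exact_mod_cast this

theorem integral_eq_center {f : ℂ → ℂ} (hf : DiffContOnCl ℂ f disk) :
    ∫ t : Circle, f t ∂m = f 0 := by
  have := integral_poisson_mul hf (z := 0) (by simp [mem_disk])
  simpa [poisson, Circle.norm_coe] using this

/-- The Herglotz transform of a function on the circle. -/
noncomputable def herglotz (g : Circle → ℂ) (z : ℂ) : ℂ :=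
  ∫ t : Circle, ((t : ℂ) + z) / ((t : ℂ) - z) * g t ∂m

theorem hasDerivAt_herglotz {g : Circle → ℂ} (hg : Integrable g m) {z : ℂ} (hz : z ∈ disk) :
    HasDerivAt (herglotz g) (∫ t : Circle, 2 * (t : ℂ) / ((t : ℂ) - z) ^ 2 * g t ∂m) z := by
  -- Circle averages need a function on the plane; its values off the circle play no role.
  set G : ℂ → ℂ := Function.extend ((↑) : Circle → ℂ) g 0
  have hG (t : Circle) : G t = g t := Subtype.val_injective.extend_apply _ _ _
  have hci : CircleIntegrable G 0 1 := by
    simp only [CircleIntegrable, circleMap_zero_one, hG]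
    exact intervalIntegrable_comp_exp hg
  have key := hasDerivAt_circleAverage_herglotzRieszKernel_smul hci hz
  have h2 : ∫ t : Circle, 2 * (t : ℂ) / ((t : ℂ) - z) ^ 2 * g t ∂m =
      Real.circleAverage (fun ζ => (2 * ζ / (ζ - z) ^ 2) • G ζ) 0 1 := by
    rw [← integral_m_eq_circleAverage]
    · simp [hG]
    · simp only [hG, smul_eq_mul]
      refine (integrable_continuous_mul (Continuous.div (by fun_prop) (by fun_prop) fun t =>
        pow_ne_zero 2 (sub_ne_zero_of_mem_disk hz t)) hg).1
  rw [h2]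
  refine key.congr_of_eventuallyEq ?_
  filter_upwards [isOpen_disk.mem_nhds hz] with w hw
  rw [← integral_m_eq_circleAverage]
  · simp [hG, herglotz, herglotzRieszKernel_def]
  · simpa [hG, herglotzRieszKernel_def] using
      (integrable_continuous_mul (continuous_herglotz hw) hg).1

theorem differentiableOn_herglotz {g : Circle → ℂ} (hg : Integrable g m) :
    DifferentiableOn ℂ (herglotz g) disk :=
  fun _ hz => (hasDerivAt_herglotz hg hz).differentiableAt.differentiableWithinAt

theorem re_herglotz_ofReal {g : Circle → ℝ} (hg : Integrable g m) {z : ℂ} (hz : z ∈ disk) :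
    (herglotz (fun t => (g t : ℂ)) z).re = ∫ t : Circle, poisson z t * g t ∂m := by
  have h := integrable_continuous_mul (continuous_herglotz hz) hg.ofReal
  have := integral_re (𝕜 := ℂ) h
  rw [herglotz]
  refine this.symm.trans (integral_congr_ae (ae_of_all _ fun t => ?_))
  simp only [RCLike.re_to_complex, ← re_herglotz]
  exact Complex.re_mul_ofReal _ _

/-! ### Radial limits of bounded holomorphic functions -/

theorem closure_disk : closure disk = Metric.closedBall 0 1 := closure_ball _ one_ne_zero

theorem diffContOnCl_mul {a F : ℂ → ℂ} (ha : DifferentiableOn ℂ a (Metric.closedBall 0 1))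
    (hF : DiffContOnCl ℂ F disk) : DiffContOnCl ℂ (fun z => a z * F z) disk := by
  rw [← closure_disk] at ha
  exact ha.diffContOnCl.smul hF

theorem exists_lipschitz_primitive {f : ℂ → ℂ} (hf : DifferentiableOn ℂ f disk) {C : ℝ}
    (hC : ∀ z ∈ disk, ‖f z‖ ≤ C) :
    ∃ F : ℂ → ℂ, (∃ K, LipschitzWith K F) ∧ ∀ z ∈ disk, HasDerivAt F (f z) z := by
  obtain ⟨g, hg⟩ := hf.isExactOn_ball
  have h1 : LipschitzOnWith C.toNNReal g disk := by
    refine Convex.lipschitzOnWith_of_nnnorm_hasDerivWithin_le (convex_ball _ _)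
      (fun x hx => (hg x hx).hasDerivWithinAt) fun x hx => ?_
    rw [← NNReal.coe_le_coe, coe_nnnorm]
    exact (hC x hx).trans (Real.le_coe_toNNReal C)
  obtain ⟨F, hF, hFg⟩ := h1.extend_finite_dimension
  refine ⟨F, ⟨_, hF⟩, fun z hz => (hg z hz).congr_of_eventuallyEq ?_⟩
  filter_upwards [isOpen_disk.mem_nhds hz] with w hw using (hFg hw).symm

theorem one_sub_conj_mul_ne_zero {z w : ℂ} (hz : z ∈ disk) (hw : ‖w‖ ≤ 1) :
    1 - conj z * w ≠ 0 := by
  intro h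
  have h1 : ‖conj z * w‖ = 1 := by rw [← sub_eq_zero.1 h, norm_one]
  rw [norm_mul, RCLike.norm_conj] at h1
  have := mem_disk.1 hz
  nlinarith [norm_nonneg z, norm_nonneg w]

theorem conj_coe_mul (t : Circle) : conj (t : ℂ) * t = 1 := by
  rw [mul_comm, Complex.mul_conj, Circle.normSq_coe, Complex.ofReal_one]

theorem conj_herglotz_kernel {z : ℂ} (hz : z ∈ disk) (t : Circle) :
    conj (((t : ℂ) + z) / (t - z)) = (1 + conj z * t) / (1 - conj z * t) := by
  have h1 : conj (t : ℂ) - conj z ≠ 0 := by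
    rw [← map_sub]; exact (map_ne_zero _).2 (sub_ne_zero_of_mem_disk hz t)
  rw [map_div₀, map_add, map_sub, div_eq_div_iff h1
    (one_sub_conj_mul_ne_zero hz (Circle.norm_coe t).le)]
  linear_combination (-2 * conj z) * conj_coe_mul t

/-- The Herglotz kernel is twice its real part, the Poisson kernel, minus its conjugate. On the
circle the conjugate is `(1 + conj z * t) / (1 - conj z * t)`, holomorphic in `t`, so against `F` it
integrates to the value at the center. -/
theorem herglotz_eq_of_diffContOnCl {F : ℂ → ℂ} (hF : DiffContOnCl ℂ F disk) {z : ℂ}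
    (hz : z ∈ disk) : herglotz (fun t => F t) z = 2 * F z - F 0 := by
  have hd : DiffContOnCl ℂ (fun w => (1 + conj z * w) / (1 - conj z * w) * F w) disk := by
    refine diffContOnCl_mul ?_ hF
    refine DifferentiableOn.div (by fun_prop) (by fun_prop) fun w hw => ?_
    exact one_sub_conj_mul_ne_zero hz (by simpa using hw)
  have h0 := integral_eq_center hd
  simp only [mul_zero, add_zero, sub_zero, div_one, one_mul] at h0
  have h1 := integral_poisson_mul hF hz
  have i1 : Integrable (fun t : Circle => (poisson z t : ℂ) * F t) m := integrable_of_continuous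
    ((Complex.continuous_ofReal.comp (continuous_poisson hz)).mul (continuous_restrict_circle hF))
  have i2 := integrable_of_continuous (continuous_restrict_circle hd)
  rw [herglotz, ← h0, ← h1, ← integral_const_mul, ← integral_sub (i1.const_mul _) i2]
  refine integral_congr_ae (ae_of_all _ fun t => ?_)
  simp only
  have h2 := Complex.add_conj (((t : ℂ) + z) / (t - z))
  rw [conj_herglotz_kernel hz, re_herglotz] at h2
  push_cast at h2
  linear_combination F t * h2

/-- The angular derivative (up to the factor `i`) of the Poisson kernel. -/
noncomputable def angularKernel (z : ℂ) (t : Circle) : ℂ :=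
  poisson z t * ((z * conj (t : ℂ) - conj z * t) / (‖(t : ℂ) - z‖ ^ 2 : ℝ))

theorem angularKernel_eq {z : ℂ} (hz : z ∈ disk) (t : Circle) :
    angularKernel z t = z * t / ((t : ℂ) - z) ^ 2 - conj z * t / (1 - conj z * t) ^ 2 := by
  have h1 := sub_ne_zero_of_mem_disk hz t
  have h2 := one_sub_conj_mul_ne_zero hz (Circle.norm_coe t).le
  have h3 : conj (t : ℂ) - conj z ≠ 0 := by
    rw [← map_sub]; exact (map_ne_zero _).2 h1
  have hn : ((‖(t : ℂ) - z‖ ^ 2 : ℝ) : ℂ) = (t - z) * (conj (t : ℂ) - conj z) := by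
    rw [← map_sub, Complex.mul_conj, Complex.normSq_eq_norm_sq]
  have hz2 : ((‖z‖ ^ 2 : ℝ) : ℂ) = z * conj z := by
    rw [Complex.mul_conj, Complex.normSq_eq_norm_sq]
  have ht := conj_coe_mul t
  have e2 : 1 - conj z * t = t * (conj (t : ℂ) - conj z) := by linear_combination -ht
  have ht0 := Circle.coe_ne_zero t
  rw [angularKernel, poisson, Complex.ofReal_div, Complex.ofReal_sub, hn, hz2, e2,
    Complex.ofReal_one]
  have ht' : conj (t : ℂ) = (t : ℂ)⁻¹ := eq_inv_of_mul_eq_one_left ht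
  rw [ht'] at h3 ⊢
  generalize conj z = y at *
  field_simp
  ring

/-- Differentiating the Herglotz formula in `z` gives the first term of `angularKernel_eq`; the
second is holomorphic in `t`, vanishes at `0` and integrates to zero against `F`. Subtracting it
matters: the first term alone has size `1 / |t - z| ^ 2`, too large near the boundary, whereas the
difference is controlled by the Poisson kernel over `|t - z|`. -/
theorem mul_deriv_eq_integral {F : ℂ → ℂ} (hF : DiffContOnCl ℂ F disk) {z f' : ℂ} (hz : z ∈ disk)
    (hd : HasDerivAt F f' z) : z * f' = ∫ t : Circle, angularKernel z t * F t ∂m := by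
  have hFc := continuous_restrict_circle hF
  have h1 : ∫ t : Circle, 2 * (t : ℂ) / ((t : ℂ) - z) ^ 2 * F t ∂m = 2 * f' := by
    refine (hasDerivAt_herglotz (integrable_of_continuous hFc) hz).unique ?_
    refine ((hd.const_mul 2).sub_const (F 0)).congr_of_eventuallyEq ?_
    filter_upwards [isOpen_disk.mem_nhds hz] with w hw using herglotz_eq_of_diffContOnCl hF hw
  have hd2 : DiffContOnCl ℂ (fun w => conj z * w / (1 - conj z * w) ^ 2 * F w) disk := by
    refine diffContOnCl_mul ?_ hF
    refine DifferentiableOn.div (by fun_prop) (by fun_prop) fun w hw => ?_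
    exact pow_ne_zero _ (one_sub_conj_mul_ne_zero hz (by simpa using hw))
  have h2 := integral_eq_center hd2
  simp only [mul_zero, zero_div, zero_mul] at h2
  have i1 : Integrable (fun t : Circle => 2 * (t : ℂ) / ((t : ℂ) - z) ^ 2 * F t) m :=
    integrable_of_continuous (Continuous.mul (Continuous.div (by fun_prop) (by fun_prop)
      fun t => pow_ne_zero 2 (sub_ne_zero_of_mem_disk hz t)) hFc)
  have i2 := integrable_of_continuous (continuous_restrict_circle hd2)
  calc z * f' = z / 2 * (2 * f') - 0 := by ring
    _ = ∫ t : Circle, (z / 2 * (2 * (t : ℂ) / ((t : ℂ) - z) ^ 2 * F t) -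
          conj z * t / (1 - conj z * t) ^ 2 * F t) ∂m := by
        rw [integral_sub (i1.const_mul _) i2, integral_const_mul, h1, h2]
    _ = _ := by
        refine integral_congr_ae (ae_of_all _ fun t => ?_)
        simp only [angularKernel_eq hz]
        ring

theorem norm_angularKernel_le {z : ℂ} (hz : z ∈ disk) (t : Circle) :
    ‖angularKernel z t‖ ≤ 2 * poisson z t / ‖(t : ℂ) - z‖ := by
  have hp := norm_sub_pos hz t
  have h1 : ‖z * conj (t : ℂ) - conj z * t‖ ≤ 2 * ‖(t : ℂ) - z‖ := by
    have : z * conj (t : ℂ) - conj z * t =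
        conj ((t : ℂ) - z) * t - (t - z) * conj (t : ℂ) := by
      rw [map_sub]; ring
    rw [this]
    refine (norm_sub_le _ _).trans (le_of_eq ?_)
    rw [norm_mul, norm_mul, RCLike.norm_conj, RCLike.norm_conj, Circle.norm_coe]
    ring
  rw [angularKernel, norm_mul, norm_div, Complex.norm_real, Complex.norm_real,
    Real.norm_of_nonneg (poisson_pos hz t).le, Real.norm_of_nonneg (by positivity)]
  calc poisson z t * (‖z * conj (t : ℂ) - conj z * t‖ / ‖(t : ℂ) - z‖ ^ 2)
      ≤ poisson z t * (2 * ‖(t : ℂ) - z‖ / ‖(t : ℂ) - z‖ ^ 2) := by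
        have := (poisson_pos hz t).le
        gcongr
    _ = _ := by field_simp

theorem ofReal_mul_mem_disk {r : ℝ} (h0 : 0 ≤ r) (h1 : r < 1) (s : Circle) :
    (r : ℂ) * s ∈ disk := by
  rw [mem_disk, norm_mul, Circle.norm_coe, Complex.norm_real, Real.norm_of_nonneg h0, mul_one]
  exact h1

theorem norm_ofReal_mul {r : ℝ} (h0 : 0 ≤ r) (s : Circle) : ‖(r : ℂ) * s‖ = r := by
  rw [norm_mul, Circle.norm_coe, Complex.norm_real, Real.norm_of_nonneg h0, mul_one]

/-- The radial gap `|s - r s| = 1 - r` is the distance from `r s` to the circle, hence at most `|t -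
r s|`. -/
theorem norm_sub_le_two_mul {r : ℝ} (h0 : 0 ≤ r) (h1 : r < 1) (s t : Circle) :
    ‖(t : ℂ) - s‖ ≤ 2 * ‖(t : ℂ) - r * s‖ := by
  have h2 : ‖(s : ℂ) - r * s‖ = 1 - r := by
    rw [show (s : ℂ) - r * s = ((1 - r : ℝ) : ℂ) * s by push_cast; ring,
      norm_ofReal_mul (by linarith)]
  have h3 : 1 - r ≤ ‖(t : ℂ) - r * s‖ := by
    have := norm_sub_norm_le (t : ℂ) (r * s)
    rwa [norm_ofReal_mul h0, Circle.norm_coe] at this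
  calc ‖(t : ℂ) - s‖ = ‖((t : ℂ) - r * s) - (s - r * s)‖ := by congr 1; ring
    _ ≤ _ := (norm_sub_le _ _).trans (by rw [h2]; linarith)

theorem poisson_le {r δ : ℝ} (h0 : 0 ≤ r) (h1 : r < 1) {s t : Circle} (hδ : 0 < δ)
    (h : δ ≤ ‖(t : ℂ) - s‖) : poisson (r * s) t ≤ 4 * (1 - r ^ 2) / δ ^ 2 := by
  have h2 := norm_sub_le_two_mul h0 h1 s t
  have h3 : 0 ≤ 1 - r ^ 2 := by nlinarith
  rw [poisson, norm_ofReal_mul h0]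
  calc (1 - r ^ 2) / ‖(t : ℂ) - r * s‖ ^ 2 ≤ (1 - r ^ 2) / (δ / 2) ^ 2 := by
        gcongr; linarith
    _ = _ := by field_simp; ring

theorem norm_angularKernel_le_near {r : ℝ} (h0 : 0 ≤ r) (h1 : r < 1) (s t : Circle) :
    ‖angularKernel (r * s) t‖ * ‖(t : ℂ) - s‖ ≤ 4 * poisson (r * s) t := by
  have hz := ofReal_mul_mem_disk h0 h1 s
  have hp := norm_sub_pos hz t
  have hq := (poisson_pos hz t).le
  calc _ ≤ 2 * poisson (r * s) t / ‖(t : ℂ) - r * s‖ * (2 * ‖(t : ℂ) - r * s‖) := by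
        gcongr
        · exact norm_angularKernel_le hz t
        · exact norm_sub_le_two_mul h0 h1 s t
    _ = _ := by field_simp; ring

theorem norm_angularKernel_le_far {r δ : ℝ} (h0 : 0 ≤ r) (h1 : r < 1) {s t : Circle} (hδ : 0 < δ)
    (h : δ ≤ ‖(t : ℂ) - s‖) :
    ‖angularKernel (r * s) t‖ ≤ 16 * (1 - r ^ 2) / δ ^ 3 := by
  have hz := ofReal_mul_mem_disk h0 h1 s
  have hp := norm_sub_pos hz t
  have hq := (poisson_pos hz t).le
  have h2 := norm_angularKernel_le_near h0 h1 s t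
  have h3 := poisson_le h0 h1 hδ h
  have : ‖angularKernel (r * s) t‖ * δ ≤ 4 * (4 * (1 - r ^ 2) / δ ^ 2) := by
    calc _ ≤ ‖angularKernel (r * s) t‖ * ‖(t : ℂ) - s‖ := by gcongr
      _ ≤ _ := by linarith
  rw [← le_div_iff₀ hδ] at this
  refine this.trans (le_of_eq ?_)
  field_simp
  ring

/-- Subtracting the affine part of `F` at `s` leaves `G` with derivative `f - c` and `G t = o(|t -
s|)` on the circle. In the kernel formula for `G`, points near `s` contribute a small multiple of
the Poisson kernel, which has mass one, while away from `s` the kernel tends to zero uniformly. -/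
theorem tendsto_radial_of_isLittleO {F f : ℂ → ℂ} (hF : DiffContOnCl ℂ F disk)
    (hFf : ∀ z ∈ disk, HasDerivAt F (f z) z) {s : Circle} {c : ℂ}
    (hs : ∀ ε > 0, ∃ δ > 0, ∀ t : Circle, ‖(t : ℂ) - s‖ < δ →
      ‖F t - F s - c * (t - s)‖ ≤ ε * ‖(t : ℂ) - s‖) :
    Tendsto (fun r : ℝ => f (r * s)) (𝓝[<] 1) (𝓝 c) := by
  set G : ℂ → ℂ := fun w => F w - F s - c * (w - s)
  have hG : DiffContOnCl ℂ G disk := (hF.sub diffContOnCl_const).sub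
    (DifferentiableOn.diffContOnCl (by fun_prop))
  obtain ⟨M, hM⟩ := exists_bound_of_continuous (continuous_restrict_circle hG)
  have hM0 : 0 ≤ M := (norm_nonneg _).trans (hM s)
  have key : Tendsto (fun r : ℝ => ((r : ℂ) * s) * (f (r * s) - c)) (𝓝[<] 1) (𝓝 0) := by
    rw [Metric.tendsto_nhds]
    intro ε hε
    -- The near estimate costs a factor 4, so `ε / 8` leaves `ε / 2` for the far part.
    obtain ⟨δ, hδ, h⟩ := hs (ε / 8) (by positivity)
    have hlim : Tendsto (fun r : ℝ => 16 * (1 - r ^ 2) / δ ^ 3 * M) (𝓝[<] 1) (𝓝 0) := by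
      have : Continuous fun r : ℝ => 16 * (1 - r ^ 2) / δ ^ 3 * M := by fun_prop
      have := this.tendsto 1
      simp only [one_pow, sub_self, mul_zero, zero_div, zero_mul] at this
      exact this.mono_left nhdsWithin_le_nhds
    filter_upwards [hlim.eventually (gt_mem_nhds (half_pos hε)),
      Ioo_mem_nhdsLT (zero_lt_one' ℝ)] with r hr ⟨h0, h1⟩
    have hz := ofReal_mul_mem_disk h0.le h1 s
    have hd : HasDerivAt G (f (r * s) - c) (r * s) := by
      have := ((hFf _ hz).sub_const (F s)).sub (((hasDerivAt_id' _).sub_const (s : ℂ)).const_mul c)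
      rwa [mul_one] at this
    rw [dist_zero_right, mul_deriv_eq_integral hG hz hd]
    have hbound : ∀ t : Circle, ‖angularKernel (r * s) t * G t‖ ≤
        ε / 2 * poisson (r * s) t + 16 * (1 - r ^ 2) / δ ^ 3 * M := by
      intro t
      have hp := (poisson_pos hz t).le
      have h3 : 0 ≤ 1 - r ^ 2 := by nlinarith
      rw [norm_mul]
      rcases lt_or_ge ‖(t : ℂ) - s‖ δ with ht | ht
      · calc _ ≤ ‖angularKernel (r * s) t‖ * (ε / 8 * ‖(t : ℂ) - s‖) := by
              gcongr; exact h t ht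
          _ = ε / 8 * (‖angularKernel (r * s) t‖ * ‖(t : ℂ) - s‖) := by ring
          _ ≤ ε / 8 * (4 * poisson (r * s) t) := by
              exact mul_le_mul_of_nonneg_left (norm_angularKernel_le_near h0.le h1 s t)
                (by positivity)
          _ = ε / 2 * poisson (r * s) t + 0 := by ring
          _ ≤ _ := by gcongr; positivity
      · calc _ ≤ 0 + 16 * (1 - r ^ 2) / δ ^ 3 * M := by
              rw [zero_add]
              gcongr
              · exact norm_angularKernel_le_far h0.le h1 hδ ht
              · exact hM t
          _ ≤ _ := by gcongr; positivity
    have hi := integrable_of_continuous (continuous_poisson hz)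
    calc _ ≤ ∫ t : Circle, (ε / 2 * poisson (r * s) t + 16 * (1 - r ^ 2) / δ ^ 3 * M) ∂m :=
          norm_integral_le_of_norm_le ((hi.const_mul _).add (integrable_const _))
            (ae_of_all _ hbound)
      _ = ε / 2 + 16 * (1 - r ^ 2) / δ ^ 3 * M := by
          rw [integral_add (hi.const_mul _) (integrable_const _), integral_const_mul,
            integral_poisson hz]
          simp
      _ < ε := by linarith
  have hr : Tendsto (fun r : ℝ => (r : ℂ) * s) (𝓝[<] 1) (𝓝 s) := by
    have : Continuous fun r : ℝ => (r : ℂ) * s := by fun_prop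
    simpa using (this.tendsto 1).mono_left nhdsWithin_le_nhds
  have h2 := (key.div hr (Circle.coe_ne_zero s)).add_const c
  rw [zero_div, zero_add] at h2
  refine h2.congr' ?_
  filter_upwards [Ioo_mem_nhdsLT (zero_lt_one' ℝ)] with r ⟨h0, _⟩
  have : (r : ℂ) * s ≠ 0 := mul_ne_zero (by exact_mod_cast h0.ne') (Circle.coe_ne_zero s)
  rw [Pi.div_apply, mul_div_cancel_left₀ _ this, sub_add_cancel]

/-- This passes from the angle to the point on the circle. The chain rule gives `c = d / (i s)`, and
an angle is at most `π / 2` times its chord, which accounts for the factors `π / 2` below. -/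
theorem exists_isLittleO_of_differentiableAt {F : ℂ → ℂ} {θ : ℝ}
    (h : DifferentiableAt ℝ (fun x : ℝ => F (Circle.exp x)) θ) :
    ∃ c : ℂ, ∀ ε > 0, ∃ δ > 0, ∀ t : Circle, ‖(t : ℂ) - Circle.exp θ‖ < δ →
      ‖F t - F (Circle.exp θ) - c * (t - Circle.exp θ)‖ ≤ ε * ‖(t : ℂ) - Circle.exp θ‖ := by
  set s := Circle.exp θ with hs
  obtain ⟨d, hd⟩ : ∃ d, HasDerivAt (fun x : ℝ => F (Circle.exp x)) d θ := ⟨_, h.hasDerivAt⟩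
  have he : HasDerivAt (fun x : ℝ => (Circle.exp x : ℂ)) (s * Complex.I) θ := by
    have := ((Complex.ofRealCLM.hasDerivAt (x := θ)).mul_const Complex.I).cexp
    simpa [hs] using this
  have hs0 : (s : ℂ) * Complex.I ≠ 0 := mul_ne_zero (Circle.coe_ne_zero s) Complex.I_ne_zero
  set c := d / (s * Complex.I)
  refine ⟨c, fun ε hε => ?_⟩
  have hg : HasDerivAt (fun x : ℝ => F (Circle.exp x) - c * Circle.exp x) 0 θ := by
    have := hd.sub (he.const_mul c)
    rwa [div_mul_cancel₀ _ hs0, sub_self] at this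
  have hpi := Real.pi_pos
  have ho := (hasDerivAt_iff_isLittleO.1 hg).def (c := ε / (Real.pi / 2)) (by positivity)
  obtain ⟨η, hη, hb⟩ := Metric.eventually_nhds_iff.1 ho
  refine ⟨η / (Real.pi / 2), by positivity, fun t ht => ?_⟩
  set a := ((t / s : Circle) : ℂ).arg
  have ha : |a| ≤ Real.pi / 2 * ‖(t : ℂ) - s‖ := by
    have h1 := Complex.angle_le_mul_norm_sub (x := t) (y := s) (Circle.norm_coe t)
      (Circle.norm_coe s)
    rwa [Complex.angle_eq_abs_arg (Circle.coe_ne_zero t) (Circle.coe_ne_zero s)] at h1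
  have hexp : Circle.exp (θ + a) = t := by
    rw [Circle.exp_add, Circle.exp_arg, ← hs, mul_div_cancel]
  have h3 := hb (y := θ + a) (by
    rw [Real.dist_eq, add_sub_cancel_left]
    rw [lt_div_iff₀ (by positivity)] at ht
    linarith)
  rw [hexp, ← hs, add_sub_cancel_left, Real.norm_eq_abs, smul_zero, sub_zero] at h3
  calc _ = ‖F t - c * t - (F s - c * s)‖ := by congr 1; ring
    _ ≤ ε / (Real.pi / 2) * |a| := h3
    _ ≤ ε / (Real.pi / 2) * (Real.pi / 2 * ‖(t : ℂ) - s‖) := by gcongr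
    _ = _ := by field_simp

theorem lipschitzWith_exp : LipschitzWith 1 fun x : ℝ => (Circle.exp x : ℂ) := by
  refine lipschitzWith_of_nnnorm_deriv_le (𝕜 := ℝ) ?_ fun x => ?_
  · simp only [Circle.coe_exp]; fun_prop
  · have h : HasDerivAt (fun x : ℝ => (Circle.exp x : ℂ)) (Circle.exp x * Complex.I) x := by
      have := ((Complex.ofRealCLM.hasDerivAt (x := x)).mul_const Complex.I).cexp
      simpa using this
    rw [h.deriv, ← NNReal.coe_le_coe, coe_nnnorm, norm_mul, Circle.norm_coe]
    simp

/-- Fatou's theorem. -/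
theorem ae_exists_tendsto_radial {f : ℂ → ℂ} (hf : DifferentiableOn ℂ f disk) {C : ℝ}
    (hC : ∀ z ∈ disk, ‖f z‖ ≤ C) :
    ∀ᵐ t : Circle ∂m, ∃ c, Tendsto (fun r : ℝ => f (r * t)) (𝓝[<] 1) (𝓝 c) := by
  obtain ⟨F, ⟨K, hK⟩, hFf⟩ := exists_lipschitz_primitive hf hC
  have hF : DiffContOnCl ℂ F disk :=
    ⟨fun z hz => (hFf z hz).differentiableAt.differentiableWithinAt, hK.continuous.continuousOn⟩
  refine ae_m_of_ae_exp ?_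
  -- A Lipschitz function of a real variable is differentiable almost everywhere.
  filter_upwards [(hK.comp lipschitzWith_exp).ae_differentiableAt_real] with θ hθ
  obtain ⟨c, hc⟩ := exists_isLittleO_of_differentiableAt (F := F) hθ
  exact ⟨c, tendsto_radial_of_isLittleO hF hFf hc⟩

theorem exists_isBoundaryDisk {f : ℂ → ℂ} (hf : DifferentiableOn ℂ f disk) {C : ℝ}
    (hC : ∀ z ∈ disk, ‖f z‖ ≤ C) : ∃ u, IsBoundaryDisk f u := by
  have h := ae_exists_tendsto_radial hf hC
  -- The shift by 2 keeps every radius in `(0, 1)`. A sequence yields a measurable limit, which by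
  -- uniqueness is the full radial limit.
  let r : ℕ → ℝ := fun n => 1 - 1 / (n + 2)
  have hr0 (n : ℕ) : 0 < 1 / ((n : ℝ) + 2) := by positivity
  have hr1 (n : ℕ) : 1 / ((n : ℝ) + 2) ≤ 1 := by
    rw [div_le_one (by positivity)]; linarith [n.cast_nonneg (α := ℝ)]
  have hr : Tendsto r atTop (𝓝[<] 1) := by
    refine tendsto_nhdsWithin_iff.2 ⟨?_, Eventually.of_forall fun n => ?_⟩
    · have h1 : Tendsto (fun n : ℕ => (n : ℝ) + 2) atTop atTop :=
        tendsto_atTop_add_const_right _ _ tendsto_natCast_atTop_atTop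
      simpa [r] using (h1.inv_tendsto_atTop).const_sub 1
    · simp only [r, Set.mem_Iio]; linarith [hr0 n]
  obtain ⟨u, hu, hlim⟩ := measurable_limit_of_tendsto_metrizable_ae (μ := m) (L := atTop)
    (f := fun (n : ℕ) (t : Circle) => f (r n * t)) (fun n => by
      refine Continuous.aemeasurable ?_
      refine hf.continuousOn.comp_continuous (by fun_prop) fun t => ?_
      exact ofReal_mul_mem_disk (by simp only [r]; linarith [hr1 n])
        (by simp only [r]; linarith [hr0 n]) t) (by
      filter_upwards [h] with t ⟨c, hc⟩ using ⟨c, hc.comp hr⟩)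
  refine ⟨u, hu, ?_⟩
  filter_upwards [h, hlim] with t ⟨c, hc⟩ ht
  rwa [tendsto_nhds_unique ht (hc.comp hr)]

/-! ### Poisson integrals and the logarithmic subharmonicity of holomorphic functions -/

theorem abs_integral_poisson_sub_le {φ : Circle → ℝ} (hφ : Continuous φ) {M : ℝ}
    (hM : ∀ t, |φ t| ≤ M) {r δ ε : ℝ} (h0 : 0 ≤ r) (h1 : r < 1) (hδ : 0 < δ) (hε : 0 ≤ ε)
    {s : Circle} (hs : ∀ t : Circle, ‖(t : ℂ) - s‖ < δ → |φ t - φ s| ≤ ε) :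
    |∫ t, poisson (r * s) t * φ t ∂m - φ s| ≤ ε + 4 * (1 - r ^ 2) / δ ^ 2 * (2 * M) := by
  have hz := ofReal_mul_mem_disk h0 h1 s
  have hpc := continuous_poisson hz
  have hM0 : 0 ≤ M := (abs_nonneg _).trans (hM s)
  have h3 : 0 ≤ 1 - r ^ 2 := by nlinarith
  have e1 : ∫ t, poisson (r * s) t * φ t ∂m - φ s =
      ∫ t, poisson (r * s) t * (φ t - φ s) ∂m := by
    simp_rw [mul_sub]
    rw [integral_sub (integrable_continuous_mul hpc (integrable_of_continuous hφ))
      ((integrable_of_continuous hpc).mul_const _), integral_mul_const, integral_poisson hz, one_mul]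
  have hb : ∀ t, ‖poisson (r * s) t * (φ t - φ s)‖ ≤
      ε * poisson (r * s) t + 4 * (1 - r ^ 2) / δ ^ 2 * (2 * M) := by
    intro t
    have hp := (poisson_pos hz t).le
    rw [norm_mul, Real.norm_of_nonneg hp, Real.norm_eq_abs]
    rcases lt_or_ge ‖(t : ℂ) - s‖ δ with ht | ht
    · calc _ ≤ poisson (r * s) t * ε + 0 := by
            rw [add_zero]; exact mul_le_mul_of_nonneg_left (hs t ht) hp
        _ ≤ _ := by rw [mul_comm]; gcongr; positivity
    · have h2 : |φ t - φ s| ≤ 2 * M := by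
        have := abs_sub (φ t) (φ s)
        linarith [hM t, hM s]
      calc _ ≤ 0 + 4 * (1 - r ^ 2) / δ ^ 2 * (2 * M) := by
            rw [zero_add]
            gcongr
            exact poisson_le h0 h1 hδ ht
        _ ≤ _ := by gcongr; positivity
  rw [e1, ← Real.norm_eq_abs]
  refine (norm_integral_le_of_norm_le (g := fun t => ε * poisson (r * s) t +
    4 * (1 - r ^ 2) / δ ^ 2 * (2 * M)) (((integrable_of_continuous hpc).const_mul _).add
    (integrable_const _)) (ae_of_all _ hb)).trans (le_of_eq ?_)
  rw [integral_add ((integrable_of_continuous hpc).const_mul _) (integrable_const _),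
    integral_const_mul, integral_poisson hz]
  simp

/-- Uniformity in `s` is the point: the maximum principle below needs the bound on an entire circle
of radius `r`. -/
theorem eventually_abs_integral_poisson_sub_lt {φ : Circle → ℝ} (hφ : Continuous φ) {ε : ℝ}
    (hε : 0 < ε) :
    ∀ᶠ r : ℝ in 𝓝[<] 1, ∀ s : Circle, |∫ t, poisson (r * s) t * φ t ∂m - φ s| < ε := by
  obtain ⟨M, hM⟩ := exists_bound_of_continuous hφ
  obtain ⟨δ, hδ, h⟩ := Metric.uniformContinuous_iff.1
    (CompactSpace.uniformContinuous_of_continuous hφ) (ε / 2) (half_pos hε)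
  have hlim : Tendsto (fun r : ℝ => 4 * (1 - r ^ 2) / δ ^ 2 * (2 * M)) (𝓝[<] 1) (𝓝 0) := by
    have : Continuous fun r : ℝ => 4 * (1 - r ^ 2) / δ ^ 2 * (2 * M) := by fun_prop
    have := this.tendsto 1
    simp only [one_pow, sub_self, mul_zero, zero_div, zero_mul] at this
    exact this.mono_left nhdsWithin_le_nhds
  filter_upwards [hlim.eventually (gt_mem_nhds (half_pos hε)),
    Ioo_mem_nhdsLT (zero_lt_one' ℝ)] with r hr ⟨h0, h1⟩ s
  have := abs_integral_poisson_sub_le hφ hM h0.le h1 hδ (half_pos hε).le (s := s) fun t ht => by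
    have h2 : dist t s < δ := by rwa [← dist_eq_norm] at ht
    exact (h h2).le
  linarith

theorem norm_exp_herglotz {g : Circle → ℝ} (hg : Integrable g m) {z : ℂ} (hz : z ∈ disk) :
    ‖Complex.exp (herglotz (fun t => (g t : ℂ)) z)‖ = Real.exp (∫ t, poisson z t * g t ∂m) := by
  rw [Complex.norm_exp, re_herglotz_ofReal hg hz]

/-- Dividing `f` by the outer function with boundary modulus `exp φ` gives a holomorphic `H` whose
modulus on circles of radius near 1 is at most nearly 1. The maximum principle bounds `H` inside. -/
theorem norm_le_exp_integral_poisson {f : ℂ → ℂ} (hf : DiffContOnCl ℂ f disk) {φ : Circle → ℝ}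
    (hφ : Continuous φ) (h : ∀ t : Circle, ‖f t‖ ≤ Real.exp (φ t)) {z : ℂ} (hz : z ∈ disk) :
    ‖f z‖ ≤ Real.exp (∫ t, poisson z t * φ t ∂m) := by
  have hφi := integrable_of_continuous hφ
  obtain ⟨B, hB⟩ := exists_bound_of_continuous (Real.continuous_exp.comp hφ.neg)
  have hfu : UniformContinuousOn f (Metric.closedBall 0 1) :=
    (isCompact_closedBall _ _).uniformContinuousOn_of_continuous (closure_disk ▸ hf.continuousOn)
  set H : ℂ → ℂ := fun w => f w * Complex.exp (-herglotz (fun t => (φ t : ℂ)) w) with hH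
  have hHd : DifferentiableOn ℂ H disk :=
    hf.differentiableOn.mul (differentiableOn_herglotz hφi.ofReal).neg.cexp
  have hHn : ∀ w ∈ disk, ‖H w‖ = ‖f w‖ * Real.exp (-∫ t, poisson w t * φ t ∂m) := by
    intro w hw
    rw [hH, norm_mul, Complex.exp_neg, norm_inv, norm_exp_herglotz hφi hw, Real.exp_neg]
  have key : ∀ η > 0, ‖H z‖ ≤ (1 + η * B) * Real.exp η := by
    intro η hη
    obtain ⟨δ, hδ, hfδ⟩ := Metric.uniformContinuousOn_iff.1 hfu η hη
    have hmem : Set.Ioo (max ‖z‖ (1 - δ)) 1 ∈ 𝓝[<] (1 : ℝ) :=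
      Ioo_mem_nhdsLT (max_lt (mem_disk.1 hz) (by linarith))
    obtain ⟨r, hr, hr0, hr1⟩ :=
      ((eventually_abs_integral_poisson_sub_lt hφ hη).and hmem).exists
    obtain ⟨hzr, hδr⟩ := max_lt_iff.1 hr0
    have hrpos : 0 < r := (norm_nonneg z).trans_lt hzr
    refine Complex.norm_le_of_forall_mem_frontier_norm_le (U := Metric.ball 0 r)
      Metric.isBounded_ball ?_ ?_ (subset_closure (by simpa using hzr))
    · refine DifferentiableOn.diffContOnCl (hHd.mono ?_)
      rw [closure_ball _ hrpos.ne']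
      exact Metric.closedBall_subset_ball hr1
    · intro w hw
      rw [frontier_ball _ hrpos.ne', mem_sphere_zero_iff_norm] at hw
      have hrC : (r : ℂ) ≠ 0 := by exact_mod_cast hrpos.ne'
      obtain ⟨s, rfl⟩ : ∃ s : Circle, w = r * s := by
        refine ⟨⟨w / r, ?_⟩, ?_⟩
        · simp [Submonoid.unitSphere, hw, abs_of_pos hrpos, hrpos.ne']
        · change w = r * (w / r)
          field_simp
      have hw' := ofReal_mul_mem_disk hrpos.le hr1 s
      have hfs : ‖f (r * s)‖ ≤ Real.exp (φ s) + η := by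
        have h1 : dist ((r : ℂ) * s) s < δ := by
          rw [dist_eq_norm, show (r : ℂ) * s - s = -(((1 - r : ℝ) : ℂ) * s) by push_cast; ring,
            norm_neg, norm_ofReal_mul (by linarith)]
          linarith
        have h2 := hfδ _ (by rw [mem_closedBall_zero_iff, hw]; exact hr1.le) _ (by simp [Circle.norm_coe]) h1
        rw [dist_eq_norm] at h2
        have h3 := norm_le_norm_add_norm_sub' (f (r * s)) (f s)
        linarith [h s]
      rw [hHn _ hw']
      have h4 := (abs_lt.1 (hr s)).1
      calc _ ≤ (Real.exp (φ s) + η) * Real.exp (-φ s + η) := by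
            gcongr; linarith
        _ = (1 + η * Real.exp (-φ s)) * Real.exp η := by
            rw [Real.exp_add, Real.exp_neg]
            field_simp
        _ ≤ _ := by
            gcongr
            exact (Real.le_norm_self _).trans (hB s)
  have hlim : Tendsto (fun η : ℝ => (1 + η * B) * Real.exp η) (𝓝[>] 0) (𝓝 1) := by
    have : Continuous fun η : ℝ => (1 + η * B) * Real.exp η := by fun_prop
    simpa using (this.tendsto 0).mono_left nhdsWithin_le_nhds
  have h1 : ‖H z‖ ≤ 1 := ge_of_tendsto hlim (eventually_mem_nhdsWithin.mono key)
  rw [hHn z hz, Real.exp_neg, ← div_eq_mul_inv, div_le_one (Real.exp_pos _)] at h1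
  exact h1

/-! ### Integrability of the logarithm of the boundary modulus -/

theorem abs_log_max_le {x ε : ℝ} (hx : x ≤ 1) (hε : 0 < ε) (hε1 : ε ≤ 1) :
    |Real.log (max x ε)| ≤ -Real.log ε := by
  rw [abs_of_nonpos (Real.log_nonpos (hε.le.trans (le_max_right _ _)) (max_le hx hε1))]
  exact neg_le_neg (Real.log_le_log hε (le_max_right _ _))

theorem continuous_log_max {X : Type*} [TopologicalSpace X] {f : X → ℝ} (hf : Continuous f)
    {ε : ℝ} (hε : 0 < ε) : Continuous fun x => Real.log (max (f x) ε) :=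
  (hf.max continuous_const).log fun _ => (hε.trans_le (le_max_right _ _)).ne'

theorem tendsto_ofReal_mul (z : ℂ) : Tendsto (fun r : ℝ => (r : ℂ) * z) (𝓝[<] 1) (𝓝 z) := by
  have : Continuous fun r : ℝ => (r : ℂ) * z := by fun_prop
  simpa using (this.tendsto 1).mono_left nhdsWithin_le_nhds

theorem norm_boundary_le {f : ℂ → ℂ} {C : ℝ} (hC : ∀ z ∈ disk, ‖f z‖ ≤ C) {p : Circle → ℂ}
    (hp : IsBoundaryDisk f p) : ∀ᵐ t ∂m, ‖p t‖ ≤ C := by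
  filter_upwards [hp.2] with t ht
  refine le_of_tendsto ht.norm ?_
  filter_upwards [Ioo_mem_nhdsLT (zero_lt_one' ℝ)] with r ⟨h0, h1⟩
  exact hC _ (ofReal_mul_mem_disk h0.le h1 t)

/-- The dilates `w ↦ f (r w)` are continuous up to the circle, so the continuous case applies to
them. Truncating at `ε` keeps the logarithm bounded, and dominated convergence lets `r → 1`. -/
theorem norm_le_exp_integral_log_max {f : ℂ → ℂ} (hf : DifferentiableOn ℂ f disk)
    (h1 : ∀ z ∈ disk, ‖f z‖ ≤ 1) {p : Circle → ℂ} (hp : IsBoundaryDisk f p) {ε : ℝ} (hε : 0 < ε)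
    (hε1 : ε ≤ 1) {z : ℂ} (hz : z ∈ disk) :
    ‖f z‖ ≤ Real.exp (∫ t, poisson z t * Real.log (max ‖p t‖ ε) ∂m) := by
  have hpc := continuous_poisson hz
  have hcont (r : ℝ) (hr : r ∈ Set.Ioo (0 : ℝ) 1) : Continuous fun t : Circle => f (r * t) :=
    hf.continuousOn.comp_continuous (by fun_prop) fun t => ofReal_mul_mem_disk hr.1.le hr.2 t
  have hleft : Tendsto (fun r : ℝ => ‖f (r * z)‖) (𝓝[<] 1) (𝓝 ‖f z‖) :=
    (((hf.differentiableAt (isOpen_disk.mem_nhds hz)).continuousAt.tendsto).comp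
      (tendsto_ofReal_mul z)).norm
  have hright : Tendsto (fun r : ℝ => ∫ t : Circle, poisson z t * Real.log (max ‖f (r * t)‖ ε) ∂m)
      (𝓝[<] 1) (𝓝 (∫ t, poisson z t * Real.log (max ‖p t‖ ε) ∂m)) := by
    refine tendsto_integral_filter_of_dominated_convergence
      (fun t => poisson z t * -Real.log ε) ?_ ?_ ((integrable_of_continuous hpc).mul_const _) ?_
    · filter_upwards [Ioo_mem_nhdsLT (zero_lt_one' ℝ)] with r hr
      exact (hpc.mul (continuous_log_max (hcont r hr).norm hε)).aestronglyMeasurable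
    · filter_upwards [Ioo_mem_nhdsLT (zero_lt_one' ℝ)] with r hr
      refine ae_of_all _ fun t => ?_
      have hp := (poisson_pos hz t).le
      rw [norm_mul, Real.norm_of_nonneg hp]
      gcongr
      exact abs_log_max_le (h1 _ (ofReal_mul_mem_disk hr.1.le hr.2 t)) hε hε1
    · filter_upwards [hp.2] with t ht
      exact (((continuous_log_max continuous_norm hε).tendsto (p t)).comp ht).const_mul _
  refine le_of_tendsto_of_tendsto hleft ((Real.continuous_exp.tendsto _).comp hright) ?_
  filter_upwards [Ioo_mem_nhdsLT (zero_lt_one' ℝ)] with r hr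
  refine norm_le_exp_integral_poisson (f := fun w => f (r * w)) ?_
    (continuous_log_max (hcont r hr).norm hε) (fun t => ?_) hz
  · refine DifferentiableOn.diffContOnCl (hf.comp (by fun_prop) ?_)
    rw [closure_disk]
    intro w hw
    rw [mem_closedBall_zero_iff] at hw
    rw [mem_disk, norm_mul, Complex.norm_real, Real.norm_of_nonneg hr.1.le]
    nlinarith [hr.1, hr.2]
  · rw [Real.exp_log (hε.trans_le (le_max_right _ _))]
    exact le_max_left _ _

theorem le_poisson {z : ℂ} (hz : z ∈ disk) (t : Circle) : (1 - ‖z‖ ^ 2) / 4 ≤ poisson z t := by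
  have h1 := one_sub_norm_sq_pos hz
  have h2 := norm_sub_pos hz t
  have h3 : ‖(t : ℂ) - z‖ ≤ 2 := by
    refine (norm_sub_le _ _).trans ?_
    rw [Circle.norm_coe]; linarith [mem_disk.1 hz]
  rw [poisson]
  gcongr
  nlinarith

/-- At a point with `f z ≠ 0`, the previous inequality and the lower bound on the Poisson kernel
bound the integrals of the truncated `-log |p|` independently of the truncation; monotone
convergence finishes. Nonvanishing is a separate conclusion because `Real.log 0 = 0` would hide
zeros of `p`. -/
theorem boundary_ne_zero_and_integrable_log {f : ℂ → ℂ} (hf : DifferentiableOn ℂ f disk)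
    (h1 : ∀ z ∈ disk, ‖f z‖ ≤ 1) {p : Circle → ℂ} (hp : IsBoundaryDisk f p)
    (h0 : ∃ z ∈ disk, f z ≠ 0) :
    (∀ᵐ t ∂m, p t ≠ 0) ∧ Integrable (fun t => Real.log ‖p t‖) m := by
  obtain ⟨z, hz, hfz⟩ := h0
  have hpm := hp.1
  have hp1 := norm_boundary_le h1 hp
  set v : ℕ → Circle → ℝ := fun n t => -Real.log (max ‖p t‖ (Real.exp (-n)))
  have he1 (n : ℕ) : Real.exp (-n) ≤ 1 := Real.exp_le_one_iff.2 (by simp)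
  have hvm (n : ℕ) : Measurable (v n) := by fun_prop
  have hvb (n : ℕ) : ∀ᵐ t ∂m, 0 ≤ v n t ∧ v n t ≤ n := by
    filter_upwards [hp1] with t ht
    have h2 := abs_log_max_le ht (Real.exp_pos (-n)) (he1 n)
    rw [Real.log_exp, neg_neg] at h2
    refine ⟨neg_nonneg.2 (Real.log_nonpos ?_ (max_le ht (he1 n))), (neg_le_abs _).trans h2⟩
    positivity
  have hvi (n : ℕ) : Integrable (v n) m := by
    refine Integrable.of_bound (hvm n).aestronglyMeasurable (n : ℝ) ?_
    filter_upwards [hvb n] with t ht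
    rw [Real.norm_of_nonneg ht.1]; exact ht.2
  set c := (1 - ‖z‖ ^ 2) / 4
  have hc : 0 < c := by have := one_sub_norm_sq_pos hz; positivity
  have hint (n : ℕ) : ∫ t, v n t ∂m ≤ -Real.log ‖f z‖ / c := by
    have h2 := norm_le_exp_integral_log_max hf h1 hp (Real.exp_pos (-n)) (he1 n) hz
    have h3 := (Real.log_le_iff_le_exp (norm_pos_iff.2 hfz)).2 h2
    have h4 : ∫ t, c * v n t ∂m ≤ ∫ t, poisson z t * v n t ∂m := by
      refine integral_mono_ae ((hvi n).const_mul c)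
        (integrable_continuous_mul (continuous_poisson hz) (hvi n)) ?_
      filter_upwards [hvb n] with t ht
      exact mul_le_mul_of_nonneg_right (le_poisson hz t) ht.1
    have h5 : ∫ t, poisson z t * v n t ∂m =
        -∫ t, poisson z t * Real.log (max ‖p t‖ (Real.exp (-n))) ∂m := by
      rw [← integral_neg]; simp [v]
    rw [integral_const_mul] at h4
    rw [le_div_iff₀ hc]
    linarith
  have hmono (t : Circle) : Monotone fun n => ENNReal.ofReal (v n t) := by
    intro a b hab
    refine ENNReal.ofReal_le_ofReal (neg_le_neg (Real.log_le_log (by positivity) ?_))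
    gcongr
  set V : Circle → ENNReal := fun t => ⨆ n, ENNReal.ofReal (v n t)
  have hVlt : ∫⁻ t, V t ∂m < ⊤ := by
    rw [lintegral_iSup (fun n => (hvm n).ennreal_ofReal) fun a b hab t => hmono t hab]
    refine lt_of_le_of_lt (iSup_le fun n => ?_)
      (ENNReal.ofReal_lt_top (r := -Real.log ‖f z‖ / c))
    rw [← ofReal_integral_eq_lintegral_ofReal (hvi n) ((hvb n).mono fun t ht => ht.1)]
    exact ENNReal.ofReal_le_ofReal (hint n)
  have hVm : Measurable V := Measurable.iSup fun n => (hvm n).ennreal_ofReal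
  have hne : ∀ᵐ t ∂m, p t ≠ 0 := by
    filter_upwards [ae_lt_top hVm hVlt.ne] with t ht hpt
    -- At a zero of `p` the truncation `v n` equals `n`, so the supremum would be infinite.
    refine ht.ne (ENNReal.eq_top_of_forall_nnreal_le fun r => ?_)
    obtain ⟨n, hn⟩ := exists_nat_ge r
    refine le_trans ?_ (le_iSup _ n)
    have : v n t = n := by
      simp [v, hpt, (Real.exp_pos _).le]
    rw [this, ENNReal.ofReal_natCast]
    exact_mod_cast hn
  refine ⟨hne, (by fun_prop : Measurable fun t => Real.log ‖p t‖).aestronglyMeasurable,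
    lt_of_le_of_lt (lintegral_mono_ae ?_) hVlt⟩
  filter_upwards [hne, hp1] with t ht ht1
  have hpos := norm_pos_iff.2 ht
  obtain ⟨n, hn⟩ := exists_nat_ge (-Real.log ‖p t‖)
  refine le_trans ?_ (le_iSup _ n)
  rw [Real.enorm_eq_ofReal_abs, abs_of_nonpos (Real.log_nonpos hpos.le ht1)]
  have : Real.exp (-n) ≤ ‖p t‖ := by
    rw [← Real.le_log_iff_exp_le hpos]; linarith
  simp only [v, max_eq_left this, le_refl]

/-- The truncation level is removed by dominated convergence: where `p t ≠ 0` the truncation is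
eventually inactive, and `|log |p||` dominates. -/
theorem norm_le_exp_integral_log {f : ℂ → ℂ} (hf : DifferentiableOn ℂ f disk)
    (h1 : ∀ z ∈ disk, ‖f z‖ ≤ 1) {p : Circle → ℂ} (hp : IsBoundaryDisk f p)
    (hne : ∀ᵐ t ∂m, p t ≠ 0) (hi : Integrable (fun t => Real.log ‖p t‖) m) {z : ℂ} (hz : z ∈ disk) :
    ‖f z‖ ≤ Real.exp (∫ t, poisson z t * Real.log ‖p t‖ ∂m) := by
  have hpm := hp.1
  have he1 (n : ℕ) : Real.exp (-n) ≤ 1 := Real.exp_le_one_iff.2 (by simp)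
  have hlim : Tendsto (fun n : ℕ => ∫ t, poisson z t * Real.log (max ‖p t‖ (Real.exp (-n))) ∂m)
      atTop (𝓝 (∫ t, poisson z t * Real.log ‖p t‖ ∂m)) := by
    refine tendsto_integral_of_dominated_convergence (fun t => poisson z t * |Real.log ‖p t‖|)
      (fun n => ?_) (integrable_continuous_mul (continuous_poisson hz) hi.abs) (fun n => ?_) ?_
    · have : Measurable fun t => Real.log (max ‖p t‖ (Real.exp (-n))) := by fun_prop
      exact ((continuous_poisson hz).measurable.mul this).aestronglyMeasurable
    · filter_upwards [hne, norm_boundary_le h1 hp] with t ht ht1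
      have hpos := norm_pos_iff.2 ht
      rw [norm_mul, Real.norm_of_nonneg (poisson_pos hz t).le]
      refine mul_le_mul_of_nonneg_left ?_ (poisson_pos hz t).le
      rw [Real.norm_eq_abs, abs_of_nonpos (Real.log_nonpos (by positivity) (max_le ht1 (he1 n))),
        abs_of_nonpos (Real.log_nonpos hpos.le ht1)]
      exact neg_le_neg (Real.log_le_log hpos (le_max_left _ _))
    · filter_upwards [hne] with t ht
      have hpos := norm_pos_iff.2 ht
      refine tendsto_const_nhds.congr' ?_
      obtain ⟨N, hN⟩ := exists_nat_ge (-Real.log ‖p t‖)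
      filter_upwards [eventually_ge_atTop N] with n hn
      have : Real.exp (-n) ≤ ‖p t‖ := by
        rw [← Real.le_log_iff_exp_le hpos]
        have : (N : ℝ) ≤ n := by exact_mod_cast hn
        linarith
      rw [max_eq_left this]
  exact ge_of_tendsto' ((Real.continuous_exp.tendsto _).comp hlim)
    fun n => norm_le_exp_integral_log_max hf h1 hp (Real.exp_pos _) (he1 n) hz

/-! ### Inner factors of bounded holomorphic functions -/

instance instSecondCountableTopologyCircle : SecondCountableTopology Circle :=
  inferInstanceAs (SecondCountableTopology (Metric.sphere (0 : ℂ) 1))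

/-- The Poisson integral of `g` on the circle of radius `r`. -/
noncomputable def poissonDilate (g : Circle → ℝ) (r : ℝ) (t : Circle) : ℝ :=
  ∫ s, poisson (r * t) s * g s ∂m

theorem poisson_symm {r : ℝ} (h0 : 0 ≤ r) (s t : Circle) :
    poisson (r * t) s = poisson (r * s) t := by
  have h : (s : ℂ) - r * t = s * t * conj ((t : ℂ) - r * s) := by
    rw [map_sub, map_mul, Complex.conj_ofReal]
    linear_combination (-(s : ℂ)) * conj_coe_mul t + r * t * conj_coe_mul s
  rw [poisson, poisson, norm_ofReal_mul h0, norm_ofReal_mul h0, h, norm_mul, norm_mul,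
    RCLike.norm_conj, Circle.norm_coe, Circle.norm_coe, one_mul, one_mul]

theorem continuous_poissonDilate {g : Circle → ℝ} (hg : Integrable g m) {r : ℝ} (h0 : 0 ≤ r)
    (h1 : r < 1) : Continuous (poissonDilate g r) := by
  have h := (differentiableOn_herglotz hg.ofReal).continuousOn.comp_continuous
    (f := fun t : Circle => (r : ℂ) * t) (by fun_prop) fun t => ofReal_mul_mem_disk h0 h1 t
  refine (Complex.continuous_re.comp h).congr fun t => ?_
  exact re_herglotz_ofReal hg (ofReal_mul_mem_disk h0 h1 t)

/-- By Fubini and the symmetry of the kernel on a fixed radius, the kernel has mass one in the other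
variable as well. -/
theorem integral_abs_poissonDilate_le {g : Circle → ℝ} (hg : Integrable g m) {r : ℝ} (h0 : 0 ≤ r)
    (h1 : r < 1) : ∫ t, |poissonDilate g r t| ∂m ≤ ∫ t, |g t| ∂m := by
  have hk : Continuous fun x : Circle × Circle => poisson (r * x.1) x.2 := by
    refine Continuous.div (by fun_prop) (by fun_prop) fun x => ?_
    exact (pow_pos (norm_sub_pos (ofReal_mul_mem_disk h0 h1 x.1) x.2) 2).ne'
  obtain ⟨C, hC⟩ := isCompact_univ.exists_bound_of_continuousOn hk.continuousOn
  have hprod : Integrable (Function.uncurry fun t s : Circle => poisson (r * t) s * |g s|)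
      (m.prod m) :=
    (hg.abs.comp_snd m).bdd_mul hk.aestronglyMeasurable (ae_of_all _ fun x => hC x trivial)
  calc _ ≤ ∫ t, ∫ s, poisson (r * t) s * |g s| ∂m ∂m := by
        refine integral_mono (integrable_of_continuous (continuous_poissonDilate hg h0 h1).abs)
          hprod.integral_prod_left fun t => ?_
        simp only [poissonDilate]
        refine (abs_integral_le_integral_abs).trans (le_of_eq (integral_congr_ae ?_))
        refine ae_of_all _ fun s => ?_
        simp only [abs_mul, abs_of_pos (poisson_pos (ofReal_mul_mem_disk h0 h1 t) s)]
    _ = ∫ s, ∫ t, poisson (r * t) s * |g s| ∂m ∂m := integral_integral_swap hprod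
    _ = _ := by
        refine integral_congr_ae (ae_of_all _ fun s => ?_)
        simp only
        rw [integral_mul_const]
        simp_rw [poisson_symm h0 s]
        rw [integral_poisson (ofReal_mul_mem_disk h0 h1 s), one_mul]

theorem poissonDilate_sub {g h : Circle → ℝ} (hg : Integrable g m) (hh : Integrable h m) {r : ℝ}
    (h0 : 0 ≤ r) (h1 : r < 1) (t : Circle) :
    poissonDilate (fun s => g s - h s) r t = poissonDilate g r t - poissonDilate h r t := by
  have hc := continuous_poisson (ofReal_mul_mem_disk h0 h1 t)
  simp only [poissonDilate, mul_sub]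
  exact integral_sub (integrable_continuous_mul hc hg) (integrable_continuous_mul hc hh)

/-- For continuous functions convergence is uniform; density in `L¹` and the contraction property
transfer it to `g`. -/
theorem tendsto_integral_abs_poissonDilate_sub {g : Circle → ℝ} (hg : Integrable g m) :
    Tendsto (fun r => ∫ t, |poissonDilate g r t - g t| ∂m) (𝓝[<] 1) (𝓝 0) := by
  rw [Metric.tendsto_nhds]
  intro ε hε
  obtain ⟨φ, hφ, hφi⟩ := hg.exists_boundedContinuous_integral_sub_le (ε := ε / 4) (by positivity)
  filter_upwards [eventually_abs_integral_poisson_sub_lt φ.continuous (ε := ε / 4) (by positivity),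
    Ioo_mem_nhdsLT (zero_lt_one' ℝ)] with r hr ⟨h0, h1⟩
  have hd : Integrable (fun t => g t - φ t) m := hg.sub hφi
  have i1 := integrable_of_continuous (continuous_poissonDilate hd h0.le h1).abs
  have i2 : Integrable (fun t => |poissonDilate (fun s => g s - φ s) r t| + ε / 4) m :=
    i1.add (integrable_const _)
  rw [Real.dist_eq, sub_zero, abs_of_nonneg (integral_nonneg fun t => abs_nonneg _)]
  calc ∫ t, |poissonDilate g r t - g t| ∂m
      ≤ ∫ t, (|poissonDilate (fun s => g s - φ s) r t| + ε / 4 + |g t - φ t|) ∂m := by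
        refine integral_mono
          ((integrable_of_continuous (continuous_poissonDilate hg h0.le h1)).sub hg).abs
          (i2.add hd.abs) fun t => ?_
        simp only [poissonDilate_sub hg hφi h0.le h1]
        have h2 : |poissonDilate φ r t - φ t| < ε / 4 := hr t
        have h3 := abs_add_three (poissonDilate g r t - poissonDilate φ r t)
          (poissonDilate φ r t - φ t) (φ t - g t)
        rw [abs_sub_comm (φ t), show poissonDilate g r t - poissonDilate φ r t +
          (poissonDilate φ r t - φ t) + (φ t - g t) = poissonDilate g r t - g t by ring] at h3
        linarith
    _ = ∫ t, |poissonDilate (fun s => g s - φ s) r t| ∂m + ε / 4 + ∫ t, |g t - φ t| ∂m := by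
        rw [integral_add i2 hd.abs,
          integral_add i1 (integrable_const _)]
        simp
    _ ≤ ε / 4 + ε / 4 + ε / 4 := by
        gcongr
        · exact (integral_abs_poissonDilate_le hd h0.le h1).trans hφ
        · exact hφ
    _ < ε := by linarith

/-- Convergence in `L¹` gives convergence a.e. along a subsequence. Nothing stronger is needed,
since full radial limits are supplied by Fatou's theorem and a sequence of radii identifies their
modulus. -/
theorem exists_seq_tendsto_poissonDilate {g : Circle → ℝ} (hg : Integrable g m) :
    ∃ r : ℕ → ℝ, Tendsto r atTop (𝓝[<] 1) ∧ (∀ n, r n ∈ Set.Ioo (0 : ℝ) 1) ∧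
      ∀ᵐ t ∂m, Tendsto (fun n => poissonDilate g (r n) t) atTop (𝓝 (g t)) := by
  obtain ⟨r, hr⟩ := exists_seq_tendsto (𝓝[<] (1 : ℝ))
  obtain ⟨N, hN⟩ := eventually_atTop.1 (hr.eventually (Ioo_mem_nhdsLT (zero_lt_one' ℝ)))
  set r' : ℕ → ℝ := fun n => r (n + N)
  have hr' : Tendsto r' atTop (𝓝[<] 1) := hr.comp (tendsto_add_atTop_nat N)
  have hmem (n : ℕ) : r' n ∈ Set.Ioo (0 : ℝ) 1 := hN _ (Nat.le_add_left _ _)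
  have hc (n : ℕ) := continuous_poissonDilate hg (hmem n).1.le (hmem n).2
  have htm : TendstoInMeasure m (fun n => poissonDilate g (r' n)) atTop g := by
    refine tendstoInMeasure_of_tendsto_eLpNorm one_ne_zero
      (fun n => (hc n).aestronglyMeasurable) hg.1 ?_
    have h := ENNReal.tendsto_ofReal ((tendsto_integral_abs_poissonDilate_sub hg).comp hr')
    rw [ENNReal.ofReal_zero] at h
    refine h.congr fun n => ?_
    rw [eLpNorm_one_eq_lintegral_enorm]
    exact ofReal_integral_norm_eq_lintegral_enorm ((integrable_of_continuous (hc n)).sub hg)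
  obtain ⟨ns, hns, hae⟩ := htm.exists_seq_tendsto_ae
  exact ⟨fun n => r' (ns n), hr'.comp hns.tendsto_atTop, fun n => hmem _, hae⟩

/-! ### Dividing out the outer factor -/

/-- The bound by 1 is `norm_le_exp_integral_log`. Along the radii of
`exists_seq_tendsto_poissonDilate` the two factors have moduli tending to `|p|` and `1 / |p|`. Since
`g` need only agree with `log |p|` a.e., one `g` can serve two functions of equal boundary modulus.
-/
theorem isInner_div_outer {f : ℂ → ℂ} (hf : DifferentiableOn ℂ f disk)
    (h1 : ∀ z ∈ disk, ‖f z‖ ≤ 1) {p : Circle → ℂ} (hp : IsBoundaryDisk f p)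
    (hne : ∀ᵐ t ∂m, p t ≠ 0) {g : Circle → ℝ} (hg : Integrable g m)
    (hgp : g =ᵐ[m] fun t => Real.log ‖p t‖) :
    IsInner fun z => f z * Complex.exp (-herglotz (fun t => (g t : ℂ)) z) := by
  set I : ℂ → ℂ := fun z => f z * Complex.exp (-herglotz (fun t => (g t : ℂ)) z) with hI
  have hId : DifferentiableOn ℂ I disk :=
    hf.mul (differentiableOn_herglotz hg.ofReal).neg.cexp
  have hIn : ∀ z ∈ disk, ‖I z‖ = ‖f z‖ * Real.exp (-∫ t, poisson z t * g t ∂m) := by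
    intro z hz
    rw [hI, norm_mul, Complex.exp_neg, norm_inv, norm_exp_herglotz hg hz, Real.exp_neg]
  have hI1 : ∀ z ∈ disk, ‖I z‖ ≤ 1 := by
    intro z hz
    have h2 : ∫ t, poisson z t * g t ∂m = ∫ t, poisson z t * Real.log ‖p t‖ ∂m := by
      refine integral_congr_ae ?_
      filter_upwards [hgp] with t ht
      rw [ht]
    have h3 := norm_le_exp_integral_log hf h1 hp hne (hg.congr hgp) hz
    rw [hIn z hz, h2, Real.exp_neg, ← div_eq_mul_inv]
    exact (div_le_one (Real.exp_pos _)).2 h3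
  obtain ⟨u, hu⟩ := exists_isBoundaryDisk hId hI1
  refine ⟨⟨hId, hI1⟩, u, hu, ?_⟩
  obtain ⟨r, hr, hmem, hlim⟩ := exists_seq_tendsto_poissonDilate hg
  filter_upwards [hu.2, hp.2, hne, hgp, hlim] with t hut hpt hnet hgt hlt
  have e1 := (hut.comp hr).norm
  have e2 := ((hpt.comp hr).norm).mul ((Real.continuous_exp.tendsto _).comp hlt.neg)
  rw [hgt, Real.exp_neg, Real.exp_log (norm_pos_iff.2 hnet),
    mul_inv_cancel₀ (norm_ne_zero_iff.2 hnet)] at e2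
  refine tendsto_nhds_unique e1 (e2.congr fun n => ?_)
  exact (hIn _ (ofReal_mul_mem_disk (hmem n).1.le (hmem n).2 t)).symm

theorem boundary_ne_zero {f : ℂ → ℂ} (hf : DifferentiableOn ℂ f disk) {C : ℝ}
    (hC : ∀ z ∈ disk, ‖f z‖ ≤ C) {p : Circle → ℂ} (hp : IsBoundaryDisk f p)
    (h0 : ∃ z ∈ disk, f z ≠ 0) : ∀ᵐ t ∂m, p t ≠ 0 := by
  have hK : 0 < max C 1 := zero_lt_one.trans_le (le_max_right _ _)
  have hKC : ((max C 1 : ℝ) : ℂ) ≠ 0 := by exact_mod_cast hK.ne'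
  obtain ⟨z, hz, hfz⟩ := h0
  have := (boundary_ne_zero_and_integrable_log (f := fun z => f z / (max C 1 : ℝ))
    (p := fun t => p t / (max C 1 : ℝ)) (hf.div_const _) (fun z hz => ?_)
    ⟨hp.1.div_const _, hp.2.mono fun t ht => ht.div_const _⟩ ⟨z, hz, div_ne_zero hfz hKC⟩).1
  · filter_upwards [this] with t ht h
    simp [h] at ht
  · rw [norm_div, Complex.norm_real, Real.norm_of_nonneg hK.le, div_le_one hK]
    exact (hC z hz).trans (le_max_left _ _)

theorem exists_ne_zero_of_boundary_ne_zero {f : ℂ → ℂ} {p : Circle → ℂ} (hp : IsBoundaryDisk f p)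
    (hne : ∀ᵐ t ∂m, p t ≠ 0) : ∃ z ∈ disk, f z ≠ 0 := by
  obtain ⟨t, ht, htne⟩ := (hp.2.and hne).exists
  obtain ⟨r, hr, h0, h1⟩ := ((ht.eventually_ne htne).and (Ioo_mem_nhdsLT (zero_lt_one' ℝ))).exists
  exact ⟨_, ofReal_mul_mem_disk h0.le h1 t, hr⟩

/-- A quotient of two bounded holomorphic functions whose boundary function is unimodular is, on the
boundary, a quotient of two inner functions. -/
theorem exists_isInner_of_norm_boundary_eq {P Q : ℂ → ℂ} (hP : DifferentiableOn ℂ P disk)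
    (hQ : DifferentiableOn ℂ Q disk) {A B : ℝ} (hA : ∀ z ∈ disk, ‖P z‖ ≤ A)
    (hB : ∀ z ∈ disk, ‖Q z‖ ≤ B) {p q : Circle → ℂ} (hp : IsBoundaryDisk P p)
    (hq : IsBoundaryDisk Q q) (hne : ∀ᵐ t ∂m, p t ≠ 0) (hpq : ∀ᵐ t ∂m, ‖p t‖ = ‖q t‖) :
    ∃ (I₁ I₂ : ℂ → ℂ) (i₁ i₂ : Circle → ℂ), IsInner I₁ ∧ IsInner I₂ ∧ IsBoundaryDisk I₁ i₁ ∧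
      IsBoundaryDisk I₂ i₂ ∧ ∀ᵐ t ∂m, p t / q t = i₂ t * (i₁ t)⁻¹ := by
  set K : ℝ := max (max A B) 1
  have hK : 0 < K := zero_lt_one.trans_le (le_max_right _ _)
  have hKC : (K : ℂ) ≠ 0 := by exact_mod_cast hK.ne'
  have hbd {f : ℂ → ℂ} {z : ℂ} (h : ‖f z‖ ≤ max A B) : ‖f z / K‖ ≤ 1 := by
    rw [norm_div, Complex.norm_real, Real.norm_of_nonneg hK.le, div_le_one hK]
    exact h.trans (le_max_left _ _)
  have hP1 : ∀ z ∈ disk, ‖P z / K‖ ≤ 1 := fun z hz => hbd ((hA z hz).trans (le_max_left _ _))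
  have hQ1 : ∀ z ∈ disk, ‖Q z / K‖ ≤ 1 := fun z hz => hbd ((hB z hz).trans (le_max_right _ _))
  have hp' : IsBoundaryDisk (fun z => P z / K) fun t => p t / K :=
    ⟨hp.1.div_const _, hp.2.mono fun t ht => ht.div_const _⟩
  have hq' : IsBoundaryDisk (fun z => Q z / K) fun t => q t / K :=
    ⟨hq.1.div_const _, hq.2.mono fun t ht => ht.div_const _⟩
  have hnep : ∀ᵐ t ∂m, p t / K ≠ 0 := hne.mono fun t ht => div_ne_zero ht hKC
  have hneq : ∀ᵐ t ∂m, q t / K ≠ 0 := by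
    filter_upwards [hne, hpq] with t ht htpq
    refine div_ne_zero (norm_ne_zero_iff.1 ?_) hKC
    rw [← htpq]; exact norm_ne_zero_iff.2 ht
  have hPd := hP.div_const (K : ℂ)
  have hQd := hQ.div_const (K : ℂ)
  have hg := (boundary_ne_zero_and_integrable_log hPd hP1 hp'
    (exists_ne_zero_of_boundary_ne_zero hp' hnep)).2
  have hI₂ := isInner_div_outer hPd hP1 hp' hnep hg .rfl
  -- The same exponent is used as for `P`, so the exponential factors cancel exactly in the final
  -- quotient.
  have hI₁ := isInner_div_outer hQd hQ1 hq' hneq hg (by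
    filter_upwards [hpq] with t ht
    rw [norm_div, norm_div, ht])
  obtain ⟨i₁, hi₁, hu₁⟩ := hI₁.2
  obtain ⟨i₂, hi₂, hu₂⟩ := hI₂.2
  refine ⟨_, _, i₁, i₂, hI₁, hI₂, hi₁, hi₂, ?_⟩
  filter_upwards [hi₁.2, hi₂.2, hu₁, hp.2, hq.2, hneq] with t h1 h2 hu hpt hqt hqne
  have hi0 : i₁ t ≠ 0 := norm_ne_zero_iff.1 (by rw [hu]; exact one_ne_zero)
  have hq0 : q t ≠ 0 := fun h => hqne (by rw [h, zero_div])
  rw [← div_eq_mul_inv]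
  refine tendsto_nhds_unique (hpt.div hqt hq0) ((h2.div h1 hi0).congr fun r => ?_)
  simp only [Pi.div_apply]
  rw [mul_div_mul_right _ _ (Complex.exp_ne_zero _), div_div_div_cancel_right₀ hKC]

/-! ### Reflection in the unit circle -/

/-- The inversion `z ↦ 1 / z` of the extended plane, with values in `ℂ`. -/
noncomputable def invSphere (x : OnePoint ℂ) : ℂ := x.elim 0 fun z => z⁻¹

@[simp]
theorem invSphere_infty : invSphere OnePoint.infty = 0 := rfl

@[simp]
theorem invSphere_coe (z : ℂ) : invSphere (z : OnePoint ℂ) = z⁻¹ := rfl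

theorem invSphere_chartInfty (w : ℂ) : invSphere (chartInfty w) = w := by
  rw [chartInfty]
  split_ifs with h
  · simp [h]
  · simp

theorem coe_mem_exterior {z : ℂ} : (z : OnePoint ℂ) ∈ exterior ↔ 1 < ‖z‖ := by
  simp [exterior]

theorem infty_mem_exterior : OnePoint.infty ∈ exterior := by
  simp [exterior]

theorem invSphere_mem_disk {x : OnePoint ℂ} (hx : x ∈ exterior) : invSphere x ∈ disk := by
  induction x using OnePoint.rec with
  | infty => simp [mem_disk]
  | coe z =>
    rw [coe_mem_exterior] at hx
    rw [mem_disk, invSphere_coe, norm_inv]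
    exact inv_lt_one_of_one_lt₀ hx

theorem chartInfty_mem_exterior {w : ℂ} (hw : w ∈ disk) : chartInfty w ∈ exterior := by
  rw [chartInfty]
  split_ifs with h
  · exact infty_mem_exterior
  · rw [coe_mem_exterior, norm_inv]
    exact (one_lt_inv₀ (norm_pos_iff.2 h)).2 (mem_disk.1 hw)

theorem chartInfty_invSphere {x : OnePoint ℂ} (hx : x ∈ exterior) :
    chartInfty (invSphere x) = x := by
  induction x using OnePoint.rec with
  | infty => simp [chartInfty]
  | coe z =>
    rw [coe_mem_exterior] at hx
    have : z ≠ 0 := norm_pos_iff.1 (by linarith)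
    simp [chartInfty, this]

theorem conj_mem_disk {z : ℂ} : conj z ∈ disk ↔ z ∈ disk := by
  rw [mem_disk, mem_disk, RCLike.norm_conj]

/-- The reflection `x ↦ conj (ψ (1 / conj x))` of a function on the disk. -/
noncomputable def reflectToExterior (ψ : ℂ → ℂ) (x : OnePoint ℂ) : ℂ :=
  conj (ψ (conj (invSphere x)))

/-- The reflection `z ↦ conj (f (1 / conj z))` of a function on the exterior domain. -/
noncomputable def reflectToDisk (f : OnePoint ℂ → ℂ) (z : ℂ) : ℂ :=
  conj (f (chartInfty (conj z)))

/-- Both reflections are this double conjugation combined with the inversion, the inversion serving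
as the chart at infinity. -/
theorem differentiableOn_conj_conj {ψ : ℂ → ℂ} (hψ : DifferentiableOn ℂ ψ disk) :
    DifferentiableOn ℂ (fun z => conj (ψ (conj z))) disk := by
  intro z hz
  have h := (hψ.differentiableAt (isOpen_disk.mem_nhds (conj_mem_disk.2 hz))).conj_conj
  rw [Complex.conj_conj] at h
  exact h.differentiableWithinAt

theorem holomorphicOnSphere_reflectToExterior {ψ : ℂ → ℂ} (hψ : DifferentiableOn ℂ ψ disk) :
    HolomorphicOnSphere (reflectToExterior ψ) exterior := by
  have h := (differentiableOn_conj_conj hψ).analyticOnNhd isOpen_disk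
  refine ⟨fun z hz => ?_, fun _ => ?_⟩
  · have hz' := invSphere_mem_disk hz
    rw [coe_mem_exterior] at hz
    have : z ≠ 0 := norm_pos_iff.1 (by linarith)
    exact (h _ hz').comp (g := fun w => conj (ψ (conj w))) (f := fun w : ℂ => w⁻¹)
      (analyticAt_inv this)
  · simp only [reflectToExterior, invSphere_chartInfty]
    exact h 0 (by simp [mem_disk])

theorem norm_reflectToExterior_le {ψ : ℂ → ℂ} {C : ℝ} (h : ∀ z ∈ disk, ‖ψ z‖ ≤ C) :
    ∀ x ∈ exterior, ‖reflectToExterior ψ x‖ ≤ C := by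
  intro x hx
  rw [reflectToExterior, RCLike.norm_conj]
  exact h _ (conj_mem_disk.2 (invSphere_mem_disk hx))

theorem differentiableOn_reflectToDisk {f : OnePoint ℂ → ℂ}
    (hf : HolomorphicOnSphere f exterior) : DifferentiableOn ℂ (reflectToDisk f) disk := by
  refine differentiableOn_conj_conj (ψ := fun w => f (chartInfty w)) fun w hw => ?_
  refine DifferentiableAt.differentiableWithinAt ?_
  by_cases h : w = 0
  · rw [h]; exact (hf.2 infty_mem_exterior).differentiableAt
  · have h1 := chartInfty_mem_exterior hw
    rw [chartInfty, if_neg h] at h1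
    have h2 := ((hf.1 _ h1).differentiableAt).comp w (differentiableAt_inv h)
    refine h2.congr_of_eventuallyEq ?_
    filter_upwards [isOpen_ne.mem_nhds h] with x hx
    simp [chartInfty, show x ≠ 0 from hx]

theorem norm_reflectToDisk_le {f : OnePoint ℂ → ℂ} {C : ℝ} (h : ∀ x ∈ exterior, ‖f x‖ ≤ C) :
    ∀ z ∈ disk, ‖reflectToDisk f z‖ ≤ C := by
  intro z hz
  rw [reflectToDisk, RCLike.norm_conj]
  exact h _ (chartInfty_mem_exterior (conj_mem_disk.2 hz))

theorem inv_coe_eq_conj (t : Circle) : (t : ℂ)⁻¹ = conj (t : ℂ) :=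
  (eq_inv_of_mul_eq_one_left (conj_coe_mul t)).symm

theorem reflectToExterior_radial (ψ : ℂ → ℂ) (r : ℝ) (t : Circle) :
    reflectToExterior ψ (((r : ℂ) * t : ℂ) : OnePoint ℂ) = conj (ψ ((r⁻¹ : ℝ) * t)) := by
  rw [reflectToExterior, invSphere_coe, mul_inv, inv_coe_eq_conj, map_mul, Complex.conj_conj,
    ← Complex.ofReal_inv, Complex.conj_ofReal]

theorem reflectToDisk_radial (f : OnePoint ℂ → ℂ) {r : ℝ} (hr : r ≠ 0) (t : Circle) :
    reflectToDisk f ((r : ℂ) * t) = conj (f (((r⁻¹ : ℝ) * t : ℂ) : OnePoint ℂ)) := by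
  have h : conj ((r : ℂ) * t) ≠ 0 :=
    (map_ne_zero _).2 (mul_ne_zero (by exact_mod_cast hr) (Circle.coe_ne_zero t))
  rw [reflectToDisk, chartInfty, if_neg h, map_mul, Complex.conj_ofReal, mul_inv,
    ← inv_coe_eq_conj, inv_inv, Complex.ofReal_inv]

theorem tendsto_inv_nhdsGT_one : Tendsto (fun r : ℝ => r⁻¹) (𝓝[>] 1) (𝓝[<] 1) := by
  refine tendsto_nhdsWithin_iff.2 ⟨?_, ?_⟩
  · simpa using ((continuousAt_inv₀ (one_ne_zero (α := ℝ))).tendsto).mono_left nhdsWithin_le_nhds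
  · filter_upwards [self_mem_nhdsWithin] with r (hr : 1 < r) using inv_lt_one_of_one_lt₀ hr

theorem tendsto_inv_nhdsLT_one : Tendsto (fun r : ℝ => r⁻¹) (𝓝[<] 1) (𝓝[>] 1) := by
  refine tendsto_nhdsWithin_iff.2 ⟨?_, ?_⟩
  · simpa using ((continuousAt_inv₀ (one_ne_zero (α := ℝ))).tendsto).mono_left nhdsWithin_le_nhds
  · filter_upwards [Ioo_mem_nhdsLT (zero_lt_one' ℝ)] with r hr using (one_lt_inv₀ hr.1).2 hr.2

/-! ### Pseudocontinuation -/

/-- An outer function is a quotient of two zero-free Schur functions. -/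
theorem IsOuter.exists_eq_div {D : ℂ → ℂ} (hD : IsOuter D) :
    ∃ f g : ℂ → ℂ, IsSchur f ∧ IsSchur g ∧ (∀ z, f z ≠ 0) ∧ (∀ z, g z ≠ 0) ∧
      ∀ z ∈ disk, D z = f z / g z := by
  obtain ⟨α, k, -, -, -, hi, hDk⟩ := hD
  -- Positive and negative parts of `log k`: each is nonnegative, so the exponential of minus its
  -- Herglotz transform is bounded by 1.
  set a : Circle → ℝ := fun t => max (Real.log (k t)) 0
  set b : Circle → ℝ := fun t => max (-Real.log (k t)) 0
  have ha : Integrable a m := hi.pos_part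
  have hb : Integrable b m := hi.neg_part
  have hnorm {c : Circle → ℝ} (hc : Integrable c m) (h0 : ∀ t, 0 ≤ c t) {z : ℂ} (hz : z ∈ disk) :
      ‖Complex.exp (-herglotz (fun t => (c t : ℂ)) z)‖ ≤ 1 := by
    rw [Complex.exp_neg, norm_inv, norm_exp_herglotz hc hz]
    refine inv_le_one_of_one_le₀ (Real.one_le_exp (integral_nonneg fun t => ?_))
    exact mul_nonneg (poisson_pos hz t).le (h0 t)
  refine ⟨fun z => α * Complex.exp (-herglotz (fun t => (b t : ℂ)) z),
    fun z => Complex.exp (-herglotz (fun t => (a t : ℂ)) z), ⟨?_, fun z hz => ?_⟩,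
    ⟨?_, fun z hz => hnorm ha (fun t => le_max_right _ _) hz⟩,
    fun z => mul_ne_zero (Circle.coe_ne_zero α) (Complex.exp_ne_zero _),
    fun z => Complex.exp_ne_zero _, fun z hz => ?_⟩
  · exact (differentiableOn_herglotz hb.ofReal).neg.cexp.const_mul _
  · rw [norm_mul, Circle.norm_coe, one_mul]
    exact hnorm hb (fun t => le_max_right _ _) hz
  · exact (differentiableOn_herglotz ha.ofReal).neg.cexp
  · rw [hDk z hz, mul_div_assoc, ← Complex.exp_sub]
    congr 2
    have hc := continuous_herglotz hz
    rw [herglotz, herglotz, neg_sub_neg]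
    refine Eq.trans (integral_congr_ae (ae_of_all _ fun t => ?_))
      (integral_sub (integrable_continuous_mul hc ha.ofReal)
        (integrable_continuous_mul hc hb.ofReal))
    simp only
    rw [← mul_sub, ← Complex.ofReal_sub]
    congr 2
    simp only [a, b]
    rcases le_total 0 (Real.log (k t)) with h | h
    · rw [max_eq_left h, max_eq_right (by linarith), sub_zero]
    · rw [max_eq_right h, max_eq_left (by linarith), zero_sub, neg_neg]

theorem IsSchur.mul {f g : ℂ → ℂ} (hf : IsSchur f) (hg : IsSchur g) :
    IsSchur fun z => f z * g z :=
  ⟨hf.1.mul hg.1, fun z hz => by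
    rw [norm_mul]; exact mul_le_one₀ (hf.2 z hz) (norm_nonneg _) (hg.2 z hz)⟩

theorem IsOuter.nevanlinnaDisk {D : ℂ → ℂ} (hD : IsOuter D) : NevanlinnaDisk D := by
  obtain ⟨f, g, hf, hg, hf0, hg0, h⟩ := hD.exists_eq_div
  refine ⟨?_, f, g, hf.1, ⟨1, hf.2⟩, hg.1, ⟨1, hg.2⟩, ⟨0, by simp [mem_disk], hg0 0⟩,
    fun z hz _ => h z hz⟩
  have hd : DifferentiableOn ℂ D disk := (hf.1.div hg.1 fun z _ => hg0 z).congr h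
  exact (hd.analyticOnNhd isOpen_disk).meromorphicOn

theorem IsInner.norm_boundary_eq_one {I : ℂ → ℂ} (hI : IsInner I) {i : Circle → ℂ}
    (hi : IsBoundaryDisk I i) : ∀ᵐ t ∂m, ‖i t‖ = 1 := by
  obtain ⟨u, hu, hu1⟩ := hI.2
  filter_upwards [hi.2, hu.2, hu1] with t h1 h2 h3
  rw [tendsto_nhds_unique h1 h2, h3]

/-- With `D = f / g`, the pseudocontinuation is the reflection of `(f I₁) / (g I₂)`, with boundary
values `conj (d i₁ / i₂) = d`. -/
theorem IsOuter.pseudocontinuable {D : ℂ → ℂ} (hD : IsOuter D) {I₁ I₂ : ℂ → ℂ} (h₁ : IsInner I₁)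
    (h₂ : IsInner I₂) {d i₁ i₂ : Circle → ℂ} (hd : IsBoundaryDisk D d)
    (hi₁ : IsBoundaryDisk I₁ i₁) (hi₂ : IsBoundaryDisk I₂ i₂)
    (h : ∀ᵐ t ∂m, d t * (conj (d t))⁻¹ = i₂ t * (i₁ t)⁻¹) : Pseudocontinuable D := by
  have hu₁ := h₁.norm_boundary_eq_one hi₁
  have hu₂ := h₂.norm_boundary_eq_one hi₂
  refine ⟨hD.nevanlinnaDisk, ?_⟩
  obtain ⟨f, g, hf, hg, -, hg0, hfg⟩ := hD.exists_eq_div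
  have hF := hf.mul h₁.1
  have hG := hg.mul h₂.1
  obtain ⟨w, hw, hIw⟩ := exists_ne_zero_of_boundary_ne_zero hi₂
    (hu₂.mono fun t ht h0 => by simp [h0] at ht)
  have hFs := holomorphicOnSphere_reflectToExterior hF.1
  have hGs := holomorphicOnSphere_reflectToExterior hG.1
  refine ⟨fun x => reflectToExterior (fun z => f z * I₁ z) x /
    reflectToExterior (fun z => g z * I₂ z) x, ⟨⟨fun z hz => ?_, fun hx => ?_⟩,
    _, _, hFs, ⟨1, norm_reflectToExterior_le hF.2⟩, hGs, ⟨1, norm_reflectToExterior_le hG.2⟩,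
    ⟨chartInfty (conj w), chartInfty_mem_exterior (conj_mem_disk.2 hw), ?_⟩, fun _ _ _ => rfl⟩,
    d, d, hd, ⟨hd.1, ?_⟩, .rfl⟩
  · exact (hFs.1 z hz).meromorphicAt.div (hGs.1 z hz).meromorphicAt
  · exact (hFs.2 hx).meromorphicAt.div (hGs.2 hx).meromorphicAt
  · rw [reflectToExterior, invSphere_chartInfty, Complex.conj_conj]
    exact (map_ne_zero _).2 (mul_ne_zero (hg0 w) hIw)
  · filter_upwards [hd.2, hi₁.2, hi₂.2, hu₁, hu₂, h] with t hdt h1t h2t hu1 hu2 ht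
    have n1 : i₁ t ≠ 0 := norm_ne_zero_iff.1 (by rw [hu1]; exact one_ne_zero)
    have n2 : i₂ t ≠ 0 := norm_ne_zero_iff.1 (by rw [hu2]; exact one_ne_zero)
    -- If `d t = 0`, the left side of the relation is `0`, but the right side is unimodular.
    have hdne : d t ≠ 0 := by
      intro h0
      rw [h0, zero_mul] at ht
      exact mul_ne_zero n2 (inv_ne_zero n1) ht.symm
    have hlim : d t = conj (d t * i₁ t / i₂ t) := by
      have hc : conj (d t) ≠ 0 := (map_ne_zero _).2 hdne
      rw [← div_eq_mul_inv, ← div_eq_mul_inv, div_eq_div_iff hc n1] at ht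
      rw [ht, mul_div_cancel_left₀ _ n2, Complex.conj_conj]
    have key := (((hdt.mul h1t).div h2t n2).comp tendsto_inv_nhdsGT_one)
    have key2 := (Complex.continuous_conj.tendsto _).comp key
    rw [← hlim] at key2
    refine key2.congr' ?_
    filter_upwards [self_mem_nhdsWithin] with r (hr : 1 < r)
    rw [reflectToExterior_radial, reflectToExterior_radial, ← map_div₀]
    simp only [Function.comp_apply, Pi.div_apply]
    rw [hfg _ (ofReal_mul_mem_disk (by positivity) (inv_lt_one_of_one_lt₀ hr) t)]
    congr 1
    rw [div_mul_eq_mul_div, div_div]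

/-- Of the outer function only the absence of zeros is used, to ensure that the numerator `f` is not
identically zero and so has nonzero boundary values a.e. -/
theorem exists_isInner_of_pseudocontinuable {D : ℂ → ℂ} (hD0 : ∀ z ∈ disk, D z ≠ 0)
    (hD : Pseudocontinuable D) :
    ∃ I₁ I₂ : ℂ → ℂ, IsInner I₁ ∧ IsInner I₂ ∧ ∃ d i₁ i₂ : Circle → ℂ,
      IsBoundaryDisk D d ∧ IsBoundaryDisk I₁ i₁ ∧ IsBoundaryDisk I₂ i₂ ∧
      ∀ᵐ t ∂m, d t * (conj (d t))⁻¹ = i₂ t * (i₁ t)⁻¹ := by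
  obtain ⟨⟨-, f, g, hf, ⟨A, hA⟩, hg, ⟨B, hB⟩, ⟨z₀, hz₀, hgz₀⟩, hfg⟩, hs,
    ⟨-, fs, gs, hfs, ⟨A', hA'⟩, hgs, ⟨B', hB'⟩, ⟨x₀, hx₀, hgx₀⟩, hfgs⟩, d, v, hd, hv, hdv⟩ := hD
  have hFd := differentiableOn_reflectToDisk hfs
  have hGd := differentiableOn_reflectToDisk hgs
  have hFb := norm_reflectToDisk_le hA'
  have hGb := norm_reflectToDisk_le hB'
  set F := reflectToDisk fs with hFdef
  set G := reflectToDisk gs with hGdef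
  obtain ⟨pf, hpf⟩ := exists_isBoundaryDisk hf hA
  obtain ⟨pg, hpg⟩ := exists_isBoundaryDisk hg hB
  obtain ⟨pF, hpF⟩ := exists_isBoundaryDisk hFd hFb
  obtain ⟨pG, hpG⟩ := exists_isBoundaryDisk hGd hGb
  have hfz₀ : f z₀ ≠ 0 := fun h0 => hD0 z₀ hz₀ (by rw [hfg z₀ hz₀ hgz₀, h0, zero_div])
  have nf := boundary_ne_zero hf hA hpf ⟨z₀, hz₀, hfz₀⟩
  have ng := boundary_ne_zero hg hB hpg ⟨z₀, hz₀, hgz₀⟩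
  have nG := boundary_ne_zero hGd hGb hpG ⟨conj (invSphere x₀),
    conj_mem_disk.2 (invSphere_mem_disk hx₀), by
      rw [hGdef, reflectToDisk, Complex.conj_conj, chartInfty_invSphere hx₀]
      exact (map_ne_zero _).2 hgx₀⟩
  have hdfg : ∀ᵐ t ∂m, d t = pf t / pg t := by
    filter_upwards [hd.2, hpf.2, hpg.2, ng] with t h1 h2 h3 h4
    refine tendsto_nhds_unique h1 ((h2.div h3 h4).congr' ?_)
    -- `D = f / g` is known only where `g ≠ 0`; this holds near the end of the radius because the
    -- limit of `g` is nonzero.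
    filter_upwards [h3.eventually_ne h4, Ioo_mem_nhdsLT (zero_lt_one' ℝ)] with r hr ⟨hr0, hr1⟩
    exact (hfg _ (ofReal_mul_mem_disk hr0.le hr1 t) hr).symm
  have hdFG : ∀ᵐ t ∂m, conj (d t) = pF t / pG t := by
    filter_upwards [hv.2, hdv, hpF.2, hpG.2, nG] with t h1 h2 h3 h4 h5
    rw [h2]
    have h6 := (Complex.continuous_conj.tendsto _).comp (h1.comp tendsto_inv_nhdsLT_one)
    refine tendsto_nhds_unique h6 ((h3.div h4 h5).congr' ?_)
    filter_upwards [h4.eventually_ne h5, Ioo_mem_nhdsLT (zero_lt_one' ℝ)] with r hr ⟨hr0, hr1⟩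
    have hne : gs (((r⁻¹ : ℝ) * t : ℂ) : OnePoint ℂ) ≠ 0 := by
      rw [hGdef, reflectToDisk_radial gs hr0.ne'] at hr
      exact (map_ne_zero _).1 hr
    have hmem : (((r⁻¹ : ℝ) * t : ℂ) : OnePoint ℂ) ∈ exterior := by
      rw [coe_mem_exterior, norm_ofReal_mul (by positivity)]
      exact (one_lt_inv₀ hr0).2 hr1
    simp only [Pi.div_apply, Function.comp_apply]
    rw [hFdef, hGdef, reflectToDisk_radial fs hr0.ne', reflectToDisk_radial gs hr0.ne', ← map_div₀,
      hfgs _ hmem hne]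
  have hmul {u w : ℂ → ℂ} {x y : ℝ} (hu : ∀ z ∈ disk, ‖u z‖ ≤ x) (hw : ∀ z ∈ disk, ‖w z‖ ≤ y) :
      ∀ z ∈ disk, ‖u z * w z‖ ≤ x * y := fun z hz => by
    rw [norm_mul]
    exact mul_le_mul (hu z hz) (hw z hz) (norm_nonneg _) ((norm_nonneg _).trans (hu z hz))
  obtain ⟨I₁, I₂, i₁, i₂, hI₁, hI₂, hi₁, hi₂, h⟩ := exists_isInner_of_norm_boundary_eq
    (P := fun z => f z * G z) (Q := fun z => g z * F z) (p := fun t => pf t * pG t)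
    (q := fun t => pg t * pF t) (hf.mul hGd) (hg.mul hFd) (hmul hA hGb) (hmul hB hFb)
    ⟨hpf.1.mul hpG.1, by filter_upwards [hpf.2, hpG.2] with t h1 h2 using h1.mul h2⟩
    ⟨hpg.1.mul hpF.1, by filter_upwards [hpg.2, hpF.2] with t h1 h2 using h1.mul h2⟩
    (by filter_upwards [nf, nG] with t h1 h2 using mul_ne_zero h1 h2) (by
      filter_upwards [hdfg, hdFG, ng, nG] with t h1 h2 h3 h4
      -- Equality of moduli of `f G` and `g F` on the circle is just `|conj d| = |d|`.
      have h5 : ‖pF t / pG t‖ = ‖pf t / pg t‖ := by rw [← h1, ← h2, RCLike.norm_conj]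
      rw [norm_div, norm_div, div_eq_div_iff (norm_ne_zero_iff.2 h4) (norm_ne_zero_iff.2 h3)] at h5
      rw [norm_mul, norm_mul, ← h5, mul_comm])
  refine ⟨I₁, I₂, hI₁, hI₂, d, i₁, i₂, hd, hi₁, hi₂, ?_⟩
  filter_upwards [h, hdfg, hdFG] with t h1 h2 h3
  rw [← h1, h3, h2, inv_div, div_mul_div_comm]

end Pseudocont

theorem proposition2p14 (D : ℂ → ℂ) (hD : Pseudocont.IsOuter D) :
    Pseudocont.Pseudocontinuable D ↔
      ∃ I₁ I₂ : ℂ → ℂ, Pseudocont.IsInner I₁ ∧ Pseudocont.IsInner I₂ ∧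
        ∃ d i₁ i₂ : Circle → ℂ,
          Pseudocont.IsBoundaryDisk D d ∧
          Pseudocont.IsBoundaryDisk I₁ i₁ ∧
          Pseudocont.IsBoundaryDisk I₂ i₂ ∧
          ∀ᵐ t ∂Pseudocont.m, d t * ((starRingEnd ℂ) (d t))⁻¹ = i₂ t * (i₁ t)⁻¹ := by
  refine ⟨Pseudocont.exists_isInner_of_pseudocontinuable fun z hz => ?_, ?_⟩
  · obtain ⟨f, g, -, -, hf, hg, h⟩ := hD.exists_eq_div
    rw [h z hz]
    exact div_ne_zero (hf z) (hg z)
  · rintro ⟨I₁, I₂, h₁, h₂, d, i₁, i₂, hd, hi₁, hi₂, h⟩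
    exact hD.pseudocontinuable h₁ h₂ hd hi₁ hi₂ h
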